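/- Let $\Gamma\subset\mathbb{R}^2$ be a (possibly irregular) lattice, that is, a set for which there is an injective map $F:\Gamma\to\mathbb{Z}^2$ with $|F(\gamma)-\gamma|<1/2$ for all $\gamma\in\Gamma$. Put $\langle x\rangle=(1+|x|^2)^{1/2}$ and $\varphi(x,x')=-\tfrac12(x_1x_2'-x_2x_1')$. Let $\alpha>3$ and let $K(x,x';b)=\overline{K(x',x;b)}$ ($x,x'\in\Gamma$, $b\in\mathbb{R}$) be a family of kernels such that $$\sup_{b\in\mathbb{R}}\ \sup_{x'\in\Gamma}\Big\{\sum_{x\in\Gamma}\langle x-x'\rangle^{2\alpha}|K(x,x';b)|^2\Big\}^{1/2}<\infty$$ and, for some constant $C$, $$\sup_{x'\in\Gamma}\sum_{x\in\Gamma}|K(x,x';b)-K(x,x';b_0)|\le C|b-b_0|\quad\text{for all } b,b_0\in\mathbb{R} \text{ with } |b-b_0|\le 1 .$$ Then for every $b\in\mathbb{R}$ the kernel $e^{ib\varphi(x,x')}K(x,x';b)$ defines a bounded self-adjoint operator $K_b$ on $\ell^2(\Gamma)$, and the following hold. (i) (Stability of the resolvent set.) For every $b_0\in\mathbb{R}$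 and $\epsilon>0$ there exist $\delta>0$ and $\eta>0$ such that, for all $z\in\mathbb{C}$ with $\mathrm{dist}(z,\sigma(K_{b_0}))\ge\epsilon$, one has $\mathrm{dist}(z,\sigma(K_b))\ge\eta$ whenever $|b-b_0|<\delta$. (ii) The functions $E_+(b)=\sup\sigma(K_b)$ and $E_-(b)=\inf\sigma(K_b)$ are Lipschitz on $\mathbb{R}$. (iii) Assume moreover $\alpha>4$. Let $(e_-(b_0),e_+(b_0))$ be a gap in the spectrum of $K_{b_0}$, with $e_-(b_0)<e_+(b_0)$ both in $\sigma(K_{b_0})$ and no spectrum in between, and let $I\ni b_0$ be a closed interval on which the gap does not close, in the sense that on every interval $J$ with $b_0\in J\subseteq I$ over which the gap can be followed continuously, its width stays bounded away from $0$. Then for every $b\in I$ the operator $K_b$ has a gap $(e_-(b),e_+(b))$ with $e_\pm(b)\in\sigma(K_b)$, which at $b_0$ is the given one, and $e_\pm$ are Lipschitz functions of $b$ on $I$. -/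

import Mathlib

open scoped ENNReal NNReal

namespace Harper

/-- The Euclidean plane. -/
abbrev Plane : Type := EuclideanSpace ℝ (Fin 2)

/-- A possibly irregular lattice: a set of points of the plane that admits an injective map
to the integer lattice which moves every point by less than one half. -/
def IsIrregularLattice (Γ : Set Plane) : Prop :=
  ∃ F : Γ → (Fin 2 → ℤ), Function.Injective F ∧
    ∀ γ : Γ, ‖WithLp.toLp 2 (fun i => (F γ i : ℝ)) - (γ : Plane)‖ < 1 / 2

/-- The Hilbert space of square summable complex functions on `Γ`. -/
abbrev Ell2 (Γ : Set Plane) : Type := lp (fun _ : Γ => ℂ) 2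

open scoped Classical in
/-- The integral kernel of a bounded operator: the value at `x` of the image of the canonical
basis vector at `x'`. -/
noncomputable def kernel {Γ : Set Plane} (T : Ell2 Γ →L[ℂ] Ell2 Γ) (x x' : Γ) : ℂ :=
  (T (lp.single 2 x' (1 : ℂ)) : Γ → ℂ) x

/-- The weight `(1 + |x|²)^(s/2)`. -/
noncomputable def weight (s : ℝ) (x : Plane) : ℝ := (1 + ‖x‖ ^ 2) ^ (s / 2)

/-- The Schur norm of a kernel, with values in `[0, ∞]`. -/
noncomputable def schurNorm {Γ : Set Plane} (k : Γ → Γ → ℂ) : ℝ≥0∞ :=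
  ⨆ x' : Γ, ∑' x : Γ, ENNReal.ofReal ‖k x x'‖

/-- The weighted uniform `ℓ²` norm of the columns of a kernel, with values in `[0, ∞]`. -/
noncomputable def hNorm {Γ : Set Plane} (α : ℝ) (k : Γ → Γ → ℂ) : ℝ≥0∞ :=
  ⨆ x' : Γ, (∑' x : Γ,
    ENNReal.ofReal (weight (2 * α) ((x : Plane) - (x' : Plane)) * ‖k x x'‖ ^ 2)) ^ (1 / 2 : ℝ)

/-- The flux of the unit magnetic field through the triangle with vertices `x`, `x'`, `0`. -/
noncomputable def flux (x x' : Plane) : ℝ := -(1 / 2) * (x 0 * x' 1 - x 1 * x' 0)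

/-- The kernel `k` multiplied by the magnetic phase at field strength `b`. -/
noncomputable def magneticKernel {Γ : Set Plane} (b : ℝ) (k : Γ → Γ → ℂ) (x x' : Γ) : ℂ :=
  Complex.exp (Complex.I * ((b * flux x x' : ℝ) : ℂ)) * k x x'

/-- The interval `(a, c)` is a gap in the spectrum of `T`, and its edges `a < c` belong to the
spectrum. -/
def IsGap {Γ : Set Plane} (T : Ell2 Γ →L[ℂ] Ell2 Γ) (a c : ℝ) : Prop :=
  a < c ∧ a ∈ spectrum ℝ T ∧ c ∈ spectrum ℝ T ∧ Disjoint (Set.Ioo a c) (spectrum ℝ T)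

/-- The functions `em`, `ep` follow a gap of the family `H` continuously over `J`. -/
def IsGapBranch {Γ : Set Plane} (H : ℝ → Ell2 Γ →L[ℂ] Ell2 Γ) (J : Set ℝ) (em ep : ℝ → ℝ) :
    Prop :=
  ContinuousOn em J ∧ ContinuousOn ep J ∧ ∀ b ∈ J, IsGap (H b) (em b) (ep b)

/-- The gap `(a, c)` of `H b₀` does not close when the parameter varies in `I`: over each
subinterval of `I` containing `b₀` along which it can be followed continuously, its width stays
away from zero. -/
def GapStaysOpen {Γ : Set Plane} (H : ℝ → Ell2 Γ →L[ℂ] Ell2 Γ) (I : Set ℝ) (b₀ a c : ℝ) :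
    Prop :=
  ∀ J : Set ℝ, J ⊆ I → J.OrdConnected → b₀ ∈ J →
    ∀ em ep : ℝ → ℝ, em b₀ = a → ep b₀ = c → IsGapBranch H J em ep →
      ∃ w : ℝ, 0 < w ∧ ∀ b ∈ J, w ≤ ep b - em b

end Harper

/-!
The key fact is that, for a self-adjoint operator with kernel `e^{ibφ} K_b`, the squared distance
`d_b(c)²` from a bounded real number `c` to the spectrum is Lipschitz in `b`, locally uniformly.
Since `d_b(c)²` is the best lower bound for `(K_b - c)²`, it suffices to see how such a bound
changes with `b`.

Let `A` be `K_{b'} - c` and `s = b - b'`. The kernel of `A² - r` is positive semidefinite, and so is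
the kernel `exp (i s φ(y, z) - |s| |y - z|² / 4)`, which is the Gram kernel of the coherent states of
the lowest Landau level; by Schur's product theorem their product is positive semidefinite
(`re_sum_mul_gaussianPhase_nonneg`). The product differs from the kernel of `B² - r`, where `B` has
the kernel `e^{isφ} A`, by the flux through the triangles `x`, `y`, `z` and by the Gaussian, and both
are of order `|s| (|x - y|² + |x - z|²)`. The Schur test then gives an error `O(|s|)`
(`le_norm_sq_of_kernel_eq_magneticKernel`). It needs `∑ ⟨x - x'⟩² |K(x, x')|` to be bounded, which
follows from the weighted `ℓ²` bound when `α > 3` (`exists_tsum_weight_mul_le`). The dependence of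
`K` itself on `b` adds another error `O(|s|)`.

The rest concerns families of compact sets of reals with this property (`SqDistLipschitz`). For `c`
in the spectrum it gives the stability of the resolvent set. For `c` beyond the spectrum, `d_b(c)`
is at least one, so that `d_b(c)` itself, and with it the edge of the spectrum, is Lipschitz. Inside
a gap of width `w` and at distance `w / 4` from an edge, the same reasoning shows that the edge moves
with speed at most `2 L / w`, over a distance in `b` that depends on `w` only (`exists_gap_near`).
A gap followed continuously is determined by its value at one point, so there is a maximal interval
over which it can be followed; there its width is bounded below by assumption, hence it can be
continued by steps of constant length, and the interval is everything (`exists_lipschitz_branch`).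
-/

namespace Harper

open ComplexConjugate

variable {Γ : Set Plane}

/-! ### Operators with a given kernel -/

lemma enorm_sq_eq_tsum (u : Ell2 Γ) : ‖u‖ₑ ^ 2 = ∑' x, ‖u x‖ₑ ^ 2 := by
  have h := lp.norm_rpow_eq_tsum (p := 2) (by norm_num) u
  have hs := (lp.memℓp u).summable (p := 2) (by norm_num)
  simp only [ENNReal.toReal_ofNat, Real.rpow_ofNat] at h hs
  have h2 := congrArg ENNReal.ofReal h
  rw [ENNReal.ofReal_tsum_of_nonneg (fun _ => by positivity) hs] at h2
  simpa [ENNReal.ofReal_pow, ofReal_norm] using h2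

lemma memℓp_two_of_tsum_ne_top {f : Γ → ℂ} (h : ∑' x, ‖f x‖ₑ ^ 2 ≠ ∞) : Memℓp f 2 := by
  refine memℓp_gen ?_
  simp only [ENNReal.toReal_ofNat, Real.rpow_ofNat]
  have := ENNReal.summable_toReal h
  simpa using this

/-- The Cauchy-Schwarz inequality with weights `a`. -/
lemma tsum_mul_sq_le {ι : Type*} (a b : ι → ℝ≥0∞) :
    (∑' i, a i * b i) ^ 2 ≤ (∑' i, a i) * ∑' i, a i * b i ^ 2 := by
  have amgm (x y : ℝ≥0∞) : 2 * (x * y) ≤ x ^ 2 + y ^ 2 := by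
    rcases eq_or_ne x ∞ with rfl | hx
    · simp
    rcases eq_or_ne y ∞ with rfl | hy
    · simp
    lift x to ℝ≥0 using hx
    lift y to ℝ≥0 using hy
    have := two_mul_le_add_sq x y
    rw [mul_assoc] at this
    exact_mod_cast this
  have h : 2 * (∑' i, a i * b i) ^ 2 ≤ 2 * ((∑' i, a i) * ∑' i, a i * b i ^ 2) := by
    calc 2 * (∑' i, a i * b i) ^ 2
        = ∑' i, ∑' j, a i * a j * (2 * (b i * b j)) := by
          rw [sq, ← ENNReal.tsum_mul_right, ← ENNReal.tsum_mul_left]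
          refine tsum_congr fun i => ?_
          rw [← ENNReal.tsum_mul_left, ← ENNReal.tsum_mul_left]
          exact tsum_congr fun j => by ring
      _ ≤ ∑' i, ∑' j, a i * a j * (b i ^ 2 + b j ^ 2) := by
          gcongr with i j
          exact amgm _ _
      _ = (∑' i, ∑' j, a i * b i ^ 2 * a j) + ∑' i, ∑' j, a i * (a j * b j ^ 2) := by
          rw [← ENNReal.tsum_add]
          refine tsum_congr fun i => ?_
          rw [← ENNReal.tsum_add]
          exact tsum_congr fun j => by ring
      _ = 2 * ((∑' i, a i) * ∑' i, a i * b i ^ 2) := by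
          simp_rw [ENNReal.tsum_mul_left, ENNReal.tsum_mul_right]
          ring
  rwa [ENNReal.mul_le_mul_iff_right (by simp) (by simp)] at h

lemma tsum_sq_schur_le {k : Γ → Γ → ℂ} {N : ℝ≥0} (hcol : ∀ y, ∑' x, ‖k x y‖ₑ ≤ N)
    (hrow : ∀ x, ∑' y, ‖k x y‖ₑ ≤ N) (u : Ell2 Γ) :
    ∑' x, (∑' y, ‖k x y * u y‖ₑ) ^ 2 ≤ (N * ‖u‖ₑ) ^ 2 := by
  calc ∑' x, (∑' y, ‖k x y * u y‖ₑ) ^ 2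
      ≤ ∑' x, N * ∑' y, ‖k x y‖ₑ * ‖u y‖ₑ ^ 2 := by
        refine ENNReal.tsum_le_tsum fun x => ?_
        simp_rw [enorm_mul]
        exact (tsum_mul_sq_le _ _).trans (by gcongr; exact hrow x)
    _ = N * ∑' y, (∑' x, ‖k x y‖ₑ) * ‖u y‖ₑ ^ 2 := by
        rw [ENNReal.tsum_mul_left, ENNReal.tsum_comm]
        simp_rw [ENNReal.tsum_mul_right]
    _ ≤ N * ∑' y, N * ‖u y‖ₑ ^ 2 := by
        gcongr with y
        exact hcol y
    _ = (N * ‖u‖ₑ) ^ 2 := by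
        rw [ENNReal.tsum_mul_left, ← enorm_sq_eq_tsum]
        ring

/-- The Schur test: a kernel with uniformly bounded column and row sums is the kernel of a bounded
operator. -/
theorem exists_kernel_eq {k : Γ → Γ → ℂ} {N : ℝ≥0} (hcol : ∀ y, ∑' x, ‖k x y‖ₑ ≤ N)
    (hrow : ∀ x, ∑' y, ‖k x y‖ₑ ≤ N) :
    ∃ T : Ell2 Γ →L[ℂ] Ell2 Γ, ‖T‖ ≤ N ∧ kernel T = k := by
  classical
  have hmain := tsum_sq_schur_le hcol hrow
  have hfin (u : Ell2 Γ) (x : Γ) : ∑' y, ‖k x y * u y‖ₑ ≠ ∞ := by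
    intro h
    have h1 := (ENNReal.le_tsum x).trans (hmain u)
    rw [h] at h1
    have : (N * ‖u‖ₑ) ^ 2 < ∞ := by
      exact ENNReal.pow_lt_top (ENNReal.mul_lt_top (by simp) (by simp))
    exact absurd (h1.trans_lt this) (by simp)
  have hsum (u : Ell2 Γ) (x : Γ) : Summable fun y => k x y * u y :=
    .of_enorm (hfin u x)
  have hle (u : Ell2 Γ) : ∑' x, ‖∑' y, k x y * u y‖ₑ ^ 2 ≤ (N * ‖u‖ₑ) ^ 2 := by
    refine le_trans (ENNReal.tsum_le_tsum fun x => ?_) (hmain u)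
    gcongr
    exact enorm_tsum_le_tsum_enorm
  have hmem (u : Ell2 Γ) : Memℓp (fun x => ∑' y, k x y * u y) 2 := by
    refine memℓp_two_of_tsum_ne_top (ne_of_lt ((hle u).trans_lt ?_))
    exact ENNReal.pow_lt_top (ENNReal.mul_lt_top (by simp) (by simp))
  let T₀ : Ell2 Γ →ₗ[ℂ] Ell2 Γ :=
    { toFun := fun u => ⟨fun x => ∑' y, k x y * u y, hmem u⟩
      map_add' := fun u v => by
        ext x
        simp only [lp.coeFn_add, Pi.add_apply, mul_add]
        exact (hsum u x).tsum_add (hsum v x)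
      map_smul' := fun c u => by
        ext x
        simp only [lp.coeFn_smul, Pi.smul_apply, smul_eq_mul, RingHom.id_apply]
        rw [← tsum_mul_left]
        exact tsum_congr fun y => by ring }
  have hbound (u : Ell2 Γ) : ‖T₀ u‖ ≤ N * ‖u‖ := by
    have h1 : ‖T₀ u‖ₑ ^ 2 ≤ (N * ‖u‖ₑ) ^ 2 := by
      rw [enorm_sq_eq_tsum]
      exact hle u
    have h2 : ‖T₀ u‖ₑ ≤ N * ‖u‖ₑ := (ENNReal.pow_le_pow_left_iff two_ne_zero).1 h1
    rw [enorm_eq_nnnorm, enorm_eq_nnnorm] at h2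
    exact_mod_cast h2
  refine ⟨T₀.mkContinuous N hbound, LinearMap.mkContinuous_norm_le _ N.2 _, ?_⟩
  ext x y
  change ∑' z, k x z * (lp.single 2 y (1 : ℂ) : Γ → ℂ) z = k x y
  rw [tsum_eq_single y]
  · simp
  · intro z hz
    simp [hz]

open scoped Classical in
/-- The canonical basis vector of `ℓ²(Γ)` at a point. -/
noncomputable def basisVec (y : Γ) : Ell2 Γ := lp.single 2 y (1 : ℂ)

lemma kernel_eq (T : Ell2 Γ →L[ℂ] Ell2 Γ) (x y : Γ) : kernel T x y = (T (basisVec y) : Γ → ℂ) x :=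
  rfl

lemma inner_basisVec (y : Γ) (u : Ell2 Γ) : inner ℂ (basisVec y) u = u y := by
  classical
  rw [basisVec, lp.inner_single_left]
  simp

open scoped Classical in
lemma basisVec_apply (x y : Γ) :
    (basisVec y : Γ → ℂ) x = if x = y then 1 else 0 := by
  rw [basisVec, lp.single_apply, Pi.single_apply]

lemma hasSum_basisVec (u : Ell2 Γ) : HasSum (fun y => u y • basisVec y) u := by
  classical
  have := lp.hasSum_single (p := 2) (by simp) u
  convert this using 2 with y
  rw [basisVec, ← lp.single_smul]
  simp

lemma norm_sum_basisVec_sq (S : Finset Γ) (u : Γ → ℂ) :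
    ‖∑ y ∈ S, u y • basisVec y‖ ^ 2 = ∑ y ∈ S, ‖u y‖ ^ 2 := by
  classical
  have := lp.norm_sum_single (E := fun _ : Γ => ℂ) (p := 2) (by simp) u S
  simp only [ENNReal.toReal_ofNat, Real.rpow_ofNat] at this
  rw [← this]
  congr 3 with y
  rw [basisVec, ← lp.single_smul]
  simp

lemma ext_of_kernel_eq {T T' : Ell2 Γ →L[ℂ] Ell2 Γ} (h : kernel T = kernel T') : T = T' := by
  have hb (y : Γ) : T (basisVec y) = T' (basisVec y) := by
    ext x
    exact congrFun (congrFun h x) y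
  ext1 u
  have h1 := (hasSum_basisVec u).mapL T
  have h2 := (hasSum_basisVec u).mapL T'
  simp only [map_smul, hb] at h1 h2
  exact h1.unique h2

lemma isSelfAdjoint_of_kernel {T : Ell2 Γ →L[ℂ] Ell2 Γ}
    (h : ∀ x y, kernel T x y = star (kernel T y x)) : IsSelfAdjoint T := by
  refine ext_of_kernel_eq ?_
  ext x y
  rw [h x y, ContinuousLinearMap.star_eq_adjoint, kernel_eq, kernel_eq, ← inner_basisVec,
    ContinuousLinearMap.adjoint_inner_right, ← inner_basisVec y, ← starRingEnd_apply,
    inner_conj_symm]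

lemma norm_le_of_kernel {T : Ell2 Γ →L[ℂ] Ell2 Γ} {N : ℝ≥0}
    (hcol : ∀ y, ∑' x, ‖kernel T x y‖ₑ ≤ N) (hrow : ∀ x, ∑' y, ‖kernel T x y‖ₑ ≤ N) :
    ‖T‖ ≤ N := by
  obtain ⟨T', hT', hk⟩ := exists_kernel_eq hcol hrow
  rwa [← ext_of_kernel_eq hk]

/-! ### Lower bounds for `(T - c)²` and the spectrum -/

/-- The real algebra structure that `spectrum ℝ T` refers to comes from the coordinates of `lp`, so
that Mathlib's results on spectra under a change of scalars do not apply directly. -/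
lemma mem_spectrum_real_iff {T : Ell2 Γ →L[ℂ] Ell2 Γ} {l : ℝ} :
    l ∈ spectrum ℝ T ↔ (l : ℂ) ∈ spectrum ℂ T := by
  have h : algebraMap ℝ (Ell2 Γ →L[ℂ] Ell2 Γ) l = algebraMap ℂ (Ell2 Γ →L[ℂ] Ell2 Γ) l := by
    ext u x
    rw [Algebra.algebraMap_eq_smul_one, Algebra.algebraMap_eq_smul_one]
    exact (Complex.real_smul).trans rfl
  rw [spectrum.mem_iff, spectrum.mem_iff, h]

section Hilbert

variable {E : Type*} [NormedAddCommGroup E] [InnerProductSpace ℂ E] [CompleteSpace E]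

/-- A self-adjoint `T` satisfies `(T - c)² ≥ r` exactly when its spectrum does. -/
theorem forall_spectrum_iff_forall_norm {T : E →L[ℂ] E} (hT : IsSelfAdjoint T)
    (c r : ℝ) :
    (∀ l : ℝ, (l : ℂ) ∈ spectrum ℂ T → r ≤ (l - c) ^ 2) ↔
      ∀ u, r * ‖u‖ ^ 2 ≤ ‖T u - (c : ℂ) • u‖ ^ 2 := by
  have hcont : ContinuousOn (fun x : ℝ => (x - c) ^ 2) (spectrum ℝ T) := by fun_prop
  have hmem (l : ℝ) : (l : ℂ) ∈ spectrum ℂ T ↔ l ∈ spectrum ℝ T := by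
    rw [← spectrum.algebraMap_mem_iff ℂ]
    rfl
  simp_rw [hmem]
  rw [← algebraMap_le_cfc_iff (fun x : ℝ => (x - c) ^ 2) r T hcont hT]
  have hcfc : cfc (fun x : ℝ => (x - c) ^ 2) T = (T - algebraMap ℝ _ c) ^ 2 := by
    rw [cfc_pow (fun x : ℝ => x - c) 2 T, cfc_sub (fun x : ℝ => x) (fun _ => c) T, cfc_id' ℝ T,
      cfc_const c T]
  have hsa : IsSelfAdjoint (T - algebraMap ℝ (E →L[ℂ] E) c) :=
    hT.sub (IsSelfAdjoint.algebraMap _ (IsSelfAdjoint.all c))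
  have happ (d : ℝ) (u : E) : algebraMap ℝ (E →L[ℂ] E) d u = (d : ℂ) • u := by
    rw [Algebra.algebraMap_eq_smul_one]
    simp
  rw [hcfc, ContinuousLinearMap.le_def, ContinuousLinearMap.isPositive_def]
  have hsq (u : E) : ((T - algebraMap ℝ _ c) ^ 2 - algebraMap ℝ _ r).reApplyInnerSelf u
      = ‖T u - (c : ℂ) • u‖ ^ 2 - r * ‖u‖ ^ 2 := by
    rw [ContinuousLinearMap.reApplyInnerSelf_apply, sub_apply, inner_sub_left,
      sq, mul_apply_eq_comp]
    have h1 := ContinuousLinearMap.adjoint_inner_left (T - algebraMap ℝ _ c) u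
      ((T - algebraMap ℝ (E →L[ℂ] E) c) u)
    rw [← ContinuousLinearMap.star_eq_adjoint, hsa.star_eq] at h1
    rw [h1, map_sub, inner_self_eq_norm_sq (𝕜 := ℂ), happ, inner_smul_left]
    rw [sub_apply, happ, Complex.conj_ofReal]
    congr 1
    have := inner_self_eq_norm_sq (𝕜 := ℂ) u
    simp only [RCLike.re_to_complex] at this ⊢
    rw [Complex.re_ofReal_mul, this]
  simp_rw [hsq, sub_nonneg]
  refine and_iff_right ?_
  exact ((hsa.pow 2).sub (IsSelfAdjoint.algebraMap _ (IsSelfAdjoint.all r))).isSymmetric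

end Hilbert

/-! ### Schur products with the damped magnetic phase -/

/-- Multiplying the entries of a positive semidefinite kernel by `exp (conj (ζ y) * ζ z)` keeps it
positive semidefinite: expand the exponential, whose `n`-th term only rescales the test vector by
`ζ ^ n`. -/
lemma re_sum_mul_exp_nonneg {ι : Type*} {S : Finset ι} {M : ι → ι → ℂ}
    (hM : ∀ u : ι → ℂ, 0 ≤ (∑ y ∈ S, ∑ z ∈ S, conj (u y) * u z * M y z).re) (ζ u : ι → ℂ) :
    0 ≤ (∑ y ∈ S, ∑ z ∈ S, conj (u y) * u z * (M y z * Complex.exp (conj (ζ y) * ζ z))).re := by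
  have hexp (w : ℂ) : HasSum (fun n : ℕ => w ^ n / n.factorial) (Complex.exp w) := by
    rw [Complex.exp_eq_exp_ℂ]
    exact NormedSpace.expSeries_div_hasSum_exp w
  have hsum : HasSum (fun n : ℕ => ∑ y ∈ S, ∑ z ∈ S,
      conj (u y) * u z * (M y z * ((conj (ζ y) * ζ z) ^ n / n.factorial)))
      (∑ y ∈ S, ∑ z ∈ S, conj (u y) * u z * (M y z * Complex.exp (conj (ζ y) * ζ z))) :=
    hasSum_sum fun y _ => hasSum_sum fun z _ => ((hexp _).mul_left _).mul_left _
  refine (Complex.hasSum_re hsum).nonneg fun n => ?_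
  have h : ∑ y ∈ S, ∑ z ∈ S,
      conj (u y) * u z * (M y z * ((conj (ζ y) * ζ z) ^ n / n.factorial)) =
      ((1 / n.factorial : ℝ) : ℂ) *
        ∑ y ∈ S, ∑ z ∈ S, conj (ζ y ^ n * u y) * (ζ z ^ n * u z) * M y z := by
    simp_rw [Finset.mul_sum]
    refine Finset.sum_congr rfl fun y _ => Finset.sum_congr rfl fun z _ => ?_
    push_cast
    rw [map_mul, map_pow]
    ring
  rw [h, Complex.re_ofReal_mul]
  exact mul_nonneg (by positivity) (hM fun y => ζ y ^ n * u y)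

/-- The magnetic phase damped by a Gaussian. It is the Gram kernel of the coherent states of the
lowest Landau level. -/
noncomputable def gaussianPhase (s : ℝ) (y z : Plane) : ℂ :=
  Complex.exp (Complex.I * ((s * flux y z : ℝ) : ℂ) - ((|s| / 4 * ‖y - z‖ ^ 2 : ℝ) : ℂ))

lemma norm_sq_plane (x : Plane) : ‖x‖ ^ 2 = x 0 ^ 2 + x 1 ^ 2 := by
  rw [EuclideanSpace.norm_sq_eq, Fin.sum_univ_two]
  simp

lemma flux_self (x : Plane) : flux x x = 0 := by
  rw [flux]
  ring

lemma flux_swap (x y : Plane) : flux y x = -flux x y := by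
  rw [flux, flux]
  ring

lemma gaussianPhase_self (s : ℝ) (y : Plane) : gaussianPhase s y y = 1 := by
  simp [gaussianPhase, flux_self]

/-- With the plane seen as `ℂ`, the damped phase is `exp (conj (ζ y) * ζ z)` up to a Gaussian factor
in each variable, where `ζ` is a multiple of the coordinate or of its conjugate, according to the
sign of `s`. -/
lemma exists_gaussianPhase_eq (s : ℝ) : ∃ (g : Plane → ℝ) (ζ : Plane → ℂ), ∀ y z,
    gaussianPhase s y z = g y * g z * Complex.exp (conj (ζ y) * ζ z) := by
  obtain ⟨e, he, hes⟩ : ∃ e : ℝ, e ^ 2 = 1 ∧ |s| * e = s := by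
    rcases le_total 0 s with h | h
    · exact ⟨1, by norm_num, by rw [abs_of_nonneg h, mul_one]⟩
    · exact ⟨-1, by norm_num, by rw [abs_of_nonpos h]; ring⟩
  obtain ⟨q, hq⟩ : ∃ q : ℝ, q ^ 2 = |s| / 2 := ⟨√(|s| / 2), Real.sq_sqrt (by positivity)⟩
  refine ⟨fun y => Real.exp (-(|s| / 4 * ‖y‖ ^ 2)), fun y => ⟨q * y 0, -(q * e * y 1)⟩,
    fun y z => ?_⟩
  rw [gaussianPhase, Complex.ofReal_exp, Complex.ofReal_exp, ← Complex.exp_add, ← Complex.exp_add]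
  congr 1
  rw [norm_sq_plane, norm_sq_plane, norm_sq_plane, flux]
  apply Complex.ext
  · simp only [Complex.sub_re, Complex.add_re, Complex.mul_re, Complex.I_re, Complex.I_im,
      Complex.ofReal_re, Complex.ofReal_im, Complex.conj_re, Complex.conj_im, PiLp.sub_apply]
    linear_combination (-(y 0 * z 0) - y 1 * z 1 * e ^ 2) * hq - |s| / 2 * y 1 * z 1 * he
  · simp only [Complex.sub_im, Complex.add_im, Complex.mul_im, Complex.I_re, Complex.I_im,
      Complex.ofReal_re, Complex.ofReal_im, Complex.conj_re, Complex.conj_im]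
    linear_combination (e * (y 0 * z 1 - y 1 * z 0)) * hq + (y 0 * z 1 - y 1 * z 0) / 2 * hes

lemma re_sum_mul_gaussianPhase_nonneg {S : Finset Γ} {M : Γ → Γ → ℂ}
    (hM : ∀ u : Γ → ℂ, 0 ≤ (∑ y ∈ S, ∑ z ∈ S, conj (u y) * u z * M y z).re) (s : ℝ)
    (u : Γ → ℂ) :
    0 ≤ (∑ y ∈ S, ∑ z ∈ S, conj (u y) * u z * (M y z * gaussianPhase s y z)).re := by
  obtain ⟨g, ζ, h⟩ := exists_gaussianPhase_eq s
  have := re_sum_mul_exp_nonneg hM (fun y => ζ y) (fun y => g y * u y)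
  convert this using 4 with y _ z _
  rw [h, map_mul, Complex.conj_ofReal]
  ring

/-- The phase of `A⋆ A` at `(y, z)`, through the intermediate point `x`, differs from the damped
phase by the flux through the triangle `x`, `y`, `z` and by the Gaussian, both quadratic in the
side lengths. -/
lemma norm_phase_sub_gaussianPhase_le (s : ℝ) (x y z : Plane) :
    ‖conj (Complex.exp (Complex.I * ((s * flux x y : ℝ) : ℂ))) *
      Complex.exp (Complex.I * ((s * flux x z : ℝ) : ℂ)) - gaussianPhase s y z‖ ≤
      |s| * ((1 + ‖x - y‖ ^ 2) * (1 + ‖x - z‖ ^ 2)) := by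
  set t : ℝ := |s| / 4 * ‖y - z‖ ^ 2 with ht
  set θ : ℝ := s * (flux x z - flux x y - flux y z) with hθ
  have ht0 : 0 ≤ t := by positivity
  have h1 : conj (Complex.exp (Complex.I * ((s * flux x y : ℝ) : ℂ))) *
      Complex.exp (Complex.I * ((s * flux x z : ℝ) : ℂ)) - gaussianPhase s y z =
      Complex.exp (Complex.I * ((s * flux y z : ℝ) : ℂ)) *
        ((Complex.exp (Complex.I * (θ : ℂ)) - 1) + ((1 - Real.exp (-t) : ℝ) : ℂ)) := by
    have hg : gaussianPhase s y z =
        Complex.exp (Complex.I * ((s * flux y z : ℝ) : ℂ)) * Complex.exp (-t : ℂ) := by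
      rw [gaussianPhase, sub_eq_add_neg, Complex.exp_add]
    have hexp : conj (Complex.exp (Complex.I * ((s * flux x y : ℝ) : ℂ))) *
        Complex.exp (Complex.I * ((s * flux x z : ℝ) : ℂ)) =
        Complex.exp (Complex.I * ((s * flux y z : ℝ) : ℂ)) *
          Complex.exp (Complex.I * (θ : ℂ)) := by
      rw [← Complex.exp_conj, ← Complex.exp_add, ← Complex.exp_add, map_mul, Complex.conj_I,
        Complex.conj_ofReal, hθ]
      congr 1
      push_cast
      ring
    rw [hg, hexp]
    push_cast
    ring
  have h2 : ‖Complex.exp (Complex.I * (θ : ℂ)) - 1‖ ≤ |θ| := Real.norm_exp_I_mul_ofReal_sub_one_le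
  have h3 : ‖((1 - Real.exp (-t) : ℝ) : ℂ)‖ ≤ t := by
    rw [Complex.norm_real, Real.norm_eq_abs, abs_of_nonneg]
    · linarith [Real.add_one_le_exp (-t)]
    · linarith [Real.exp_le_one_iff.2 (neg_nonpos.2 ht0)]
  have h4 : |flux x z - flux x y - flux y z| ≤ (‖x - y‖ ^ 2 + ‖x - z‖ ^ 2) / 4 := by
    rw [norm_sq_plane, norm_sq_plane, flux, flux, flux, abs_le]
    simp only [PiLp.sub_apply]
    constructor
    · nlinarith [sq_nonneg ((x 0 - y 0) - (x 1 - z 1)), sq_nonneg ((x 1 - y 1) + (x 0 - z 0)),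
        sq_nonneg ((x 0 - y 0) + (x 1 - z 1)), sq_nonneg ((x 1 - y 1) - (x 0 - z 0))]
    · nlinarith [sq_nonneg ((x 0 - y 0) - (x 1 - z 1)), sq_nonneg ((x 1 - y 1) + (x 0 - z 0)),
        sq_nonneg ((x 0 - y 0) + (x 1 - z 1)), sq_nonneg ((x 1 - y 1) - (x 0 - z 0))]
  have h5 : ‖y - z‖ ^ 2 ≤ 2 * (‖x - y‖ ^ 2 + ‖x - z‖ ^ 2) := by
    rw [norm_sq_plane, norm_sq_plane, norm_sq_plane]
    simp only [PiLp.sub_apply]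
    nlinarith [sq_nonneg ((x 0 - y 0) + (x 0 - z 0)), sq_nonneg ((x 1 - y 1) + (x 1 - z 1))]
  rw [h1, norm_mul, mul_comm Complex.I, Complex.norm_exp_ofReal_mul_I, one_mul]
  calc _ ≤ |θ| + t := (norm_add_le _ _).trans (add_le_add h2 h3)
    _ ≤ |s| * ((‖x - y‖ ^ 2 + ‖x - z‖ ^ 2) / 4) +
        |s| / 4 * (2 * (‖x - y‖ ^ 2 + ‖x - z‖ ^ 2)) := by
        rw [hθ, abs_mul, ht]
        exact add_le_add (mul_le_mul_of_nonneg_left h4 (abs_nonneg s))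
          (mul_le_mul_of_nonneg_left h5 (by positivity))
    _ = |s| * (3 / 4 * (‖x - y‖ ^ 2 + ‖x - z‖ ^ 2)) := by ring
    _ ≤ _ := by
        refine mul_le_mul_of_nonneg_left ?_ (abs_nonneg s)
        nlinarith [sq_nonneg ‖x - y‖, sq_nonneg ‖x - z‖,
          mul_nonneg (sq_nonneg ‖x - y‖) (sq_nonneg ‖x - z‖)]

/-- The Schur test for finite quadratic forms. -/
lemma norm_sum_sum_le {ι : Type*} {S : Finset ι} {e : ι → ι → ℂ} {D : ℝ}
    (hcol : ∀ z, ∑ y ∈ S, ‖e y z‖ ≤ D) (hrow : ∀ y, ∑ z ∈ S, ‖e y z‖ ≤ D) (u : ι → ℂ) :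
    ‖∑ y ∈ S, ∑ z ∈ S, conj (u y) * u z * e y z‖ ≤ D * ∑ y ∈ S, ‖u y‖ ^ 2 := by
  calc ‖∑ y ∈ S, ∑ z ∈ S, conj (u y) * u z * e y z‖
      ≤ ∑ y ∈ S, ∑ z ∈ S, ‖conj (u y) * u z * e y z‖ :=
        (norm_sum_le _ _).trans (Finset.sum_le_sum fun y _ => norm_sum_le _ _)
    _ ≤ ∑ y ∈ S, ∑ z ∈ S, (‖u y‖ ^ 2 / 2 * ‖e y z‖ + ‖u z‖ ^ 2 / 2 * ‖e y z‖) := by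
        refine Finset.sum_le_sum fun y _ => Finset.sum_le_sum fun z _ => ?_
        rw [norm_mul, norm_mul, RCLike.norm_conj, ← add_mul]
        gcongr
        linarith [two_mul_le_add_sq ‖u y‖ ‖u z‖]
    _ = (∑ y ∈ S, ‖u y‖ ^ 2 / 2 * ∑ z ∈ S, ‖e y z‖) +
        ∑ z ∈ S, ‖u z‖ ^ 2 / 2 * ∑ y ∈ S, ‖e y z‖ := by
        simp_rw [Finset.sum_add_distrib, Finset.mul_sum]
        rw [Finset.sum_comm (f := fun y z => ‖u z‖ ^ 2 / 2 * ‖e y z‖)]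
    _ ≤ (∑ y ∈ S, ‖u y‖ ^ 2 / 2 * D) + ∑ z ∈ S, ‖u z‖ ^ 2 / 2 * D := by
        gcongr with y _ z _
        · exact hrow y
        · exact hcol z
    _ = D * ∑ y ∈ S, ‖u y‖ ^ 2 := by
        rw [← Finset.sum_add_distrib, Finset.mul_sum]
        exact Finset.sum_congr rfl fun y _ => by ring

/-- The quadratic weight times the modulus of the kernel of an operator. -/
noncomputable def weightedKernel (A : Ell2 Γ →L[ℂ] Ell2 Γ) (x y : Γ) : ℝ≥0∞ :=
  ENNReal.ofReal (1 + ‖(x : Plane) - y‖ ^ 2) * ‖kernel A x y‖ₑ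

lemma enorm_inner_sub_le {A B : Ell2 Γ →L[ℂ] Ell2 Γ} {s : ℝ}
    (hB : kernel B = magneticKernel s (kernel A)) (y z : Γ) :
    ‖inner ℂ (B (basisVec y)) (B (basisVec z)) -
      inner ℂ (A (basisVec y)) (A (basisVec z)) * gaussianPhase s y z‖ₑ ≤
    ENNReal.ofReal |s| * ∑' x, weightedKernel A x y * weightedKernel A x z := by
  have h1 := lp.hasSum_inner (𝕜 := ℂ) (B (basisVec y)) (B (basisVec z))
  have h2 := (lp.hasSum_inner (𝕜 := ℂ) (A (basisVec y)) (A (basisVec z))).mul_right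
    (gaussianPhase s y z)
  rw [← (h1.sub h2).tsum_eq, ← ENNReal.tsum_mul_left]
  refine enorm_tsum_le_tsum_enorm.trans (ENNReal.tsum_le_tsum fun x => ?_)
  simp only [← kernel_eq, hB, magneticKernel, RCLike.inner_apply]
  have h3 : Complex.exp (Complex.I * ((s * flux x z : ℝ) : ℂ)) * kernel A x z *
      conj (Complex.exp (Complex.I * ((s * flux x y : ℝ) : ℂ)) * kernel A x y) -
      kernel A x z * conj (kernel A x y) * gaussianPhase s y z =
      (conj (Complex.exp (Complex.I * ((s * flux x y : ℝ) : ℂ))) *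
        Complex.exp (Complex.I * ((s * flux x z : ℝ) : ℂ)) - gaussianPhase s y z) *
        (conj (kernel A x y) * kernel A x z) := by
    rw [map_mul]
    ring
  rw [h3, enorm_mul, enorm_mul, weightedKernel, weightedKernel]
  have h4 := ENNReal.ofReal_le_ofReal (norm_phase_sub_gaussianPhase_le s x y z)
  rw [ofReal_norm, ENNReal.ofReal_mul (abs_nonneg s), ENNReal.ofReal_mul (by positivity)] at h4
  have h5 : ‖conj (kernel A x y)‖ₑ = ‖kernel A x y‖ₑ := by
    rw [← ofReal_norm, RCLike.norm_conj, ofReal_norm]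
  rw [h5]
  refine (mul_le_mul_left h4 _).trans (le_of_eq ?_)
  ring

lemma tsum_weightedKernel_mul_le {A : Ell2 Γ →L[ℂ] Ell2 Γ} {N : ℝ≥0}
    (hcol : ∀ y, ∑' x, weightedKernel A x y ≤ N) (hrow : ∀ x, ∑' y, weightedKernel A x y ≤ N)
    (z : Γ) : ∑' y, ∑' x, weightedKernel A x y * weightedKernel A x z ≤ (N : ℝ≥0∞) ^ 2 := by
  rw [ENNReal.tsum_comm]
  simp_rw [ENNReal.tsum_mul_right]
  calc _ ≤ ∑' x, N * weightedKernel A x z := by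
        gcongr with x
        exact hrow x
    _ ≤ (N : ℝ≥0∞) ^ 2 := by
        rw [ENNReal.tsum_mul_left, sq]
        gcongr
        exact hcol z

/-- A lower bound `r` for `A⋆ A` becomes `r - N² |s|` when the kernel of `A` acquires the phase of a
magnetic field `s`: the kernel `⟪A e_y, A e_z⟫ - r δ_yz` is positive semidefinite, it stays so after
multiplication by the damped phase, and the Schur test controls the difference of the result with
`⟪B e_y, B e_z⟫ - r δ_yz`. -/
theorem le_norm_sq_of_kernel_eq_magneticKernel {A B : Ell2 Γ →L[ℂ] Ell2 Γ} {s : ℝ} {N : ℝ≥0}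
    (hB : kernel B = magneticKernel s (kernel A))
    (hcol : ∀ y, ∑' x, weightedKernel A x y ≤ N) (hrow : ∀ x, ∑' y, weightedKernel A x y ≤ N)
    {r : ℝ} (hr : ∀ u, r * ‖u‖ ^ 2 ≤ ‖A u‖ ^ 2) (u : Ell2 Γ) :
    (r - N ^ 2 * |s|) * ‖u‖ ^ 2 ≤ ‖B u‖ ^ 2 := by
  classical
  have hform (T : Ell2 Γ →L[ℂ] Ell2 Γ) (S : Finset Γ) (v : Γ → ℂ) :
      ‖T (∑ y ∈ S, v y • basisVec y)‖ ^ 2 = (∑ y ∈ S, ∑ z ∈ S,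
        conj (v y) * v z * inner ℂ (T (basisVec y)) (T (basisVec z))).re := by
    rw [← inner_self_eq_norm_sq (𝕜 := ℂ), map_sum, sum_inner]
    simp_rw [inner_sum, map_smul, inner_smul_left, inner_smul_right, mul_assoc]
    rfl
  have hfin (S : Finset Γ) (v : Γ → ℂ) :
      (r - N ^ 2 * |s|) * ∑ y ∈ S, ‖v y‖ ^ 2 ≤ ‖B (∑ y ∈ S, v y • basisVec y)‖ ^ 2 := by
    let δ (y z : Γ) : ℂ := if y = z then (r : ℂ) else 0
    have hδ (w : Γ → ℂ) (P : Γ → Γ → ℂ) (hP : ∀ y, P y y = 1) :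
        (∑ y ∈ S, ∑ z ∈ S, conj (w y) * w z * (δ y z * P y z)).re =
          r * ∑ y ∈ S, ‖w y‖ ^ 2 := by
      have : ∑ y ∈ S, ∑ z ∈ S, conj (w y) * w z * (δ y z * P y z) =
          ((r * ∑ y ∈ S, ‖w y‖ ^ 2 : ℝ) : ℂ) := by
        push_cast
        rw [Finset.mul_sum]
        refine Finset.sum_congr rfl fun y hy => ?_
        rw [Finset.sum_eq_single y]
        · simp only [δ, if_true, hP, mul_one]
          rw [← Complex.conj_mul']
          ring
        · intro z _ hz
          simp [δ, hz.symm]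
        · exact fun h => absurd hy h
      rw [this, Complex.ofReal_re]
    have hpos (w : Γ → ℂ) : 0 ≤ (∑ y ∈ S, ∑ z ∈ S, conj (w y) * w z *
        (inner ℂ (A (basisVec y)) (A (basisVec z)) - δ y z)).re := by
      have h1 := hr (∑ y ∈ S, w y • basisVec y)
      rw [hform, norm_sum_basisVec_sq, ← hδ w (fun _ _ => 1) (fun _ => rfl)] at h1
      simp_rw [mul_sub, Finset.sum_sub_distrib, Complex.sub_re]
      simpa using h1
    have hpos' := re_sum_mul_gaussianPhase_nonneg hpos s v
    let e (y z : Γ) : ℂ := inner ℂ (B (basisVec y)) (B (basisVec z)) -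
      inner ℂ (A (basisVec y)) (A (basisVec z)) * gaussianPhase s y z
    have hsum {f : Γ → ℂ} {d : Γ → ℝ≥0∞} (h : ∀ y, ‖f y‖ₑ ≤ ENNReal.ofReal |s| * d y)
        (hd : ∑' y, d y ≤ (N : ℝ≥0∞) ^ 2) : ∑ y ∈ S, ‖f y‖ ≤ N ^ 2 * |s| := by
      have h1 : ENNReal.ofReal (∑ y ∈ S, ‖f y‖) ≤ ENNReal.ofReal (N ^ 2 * |s|) := by
        rw [ENNReal.ofReal_sum_of_nonneg fun _ _ => norm_nonneg _]
        simp_rw [ofReal_norm]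
        calc ∑ y ∈ S, ‖f y‖ₑ ≤ ∑' y, ENNReal.ofReal |s| * d y :=
              (Finset.sum_le_sum fun y _ => h y).trans (ENNReal.sum_le_tsum S)
          _ ≤ ENNReal.ofReal |s| * (N : ℝ≥0∞) ^ 2 := by
              rw [ENNReal.tsum_mul_left]
              gcongr
          _ = ENNReal.ofReal (N ^ 2 * |s|) := by
              rw [ENNReal.ofReal_mul (by positivity), mul_comm, ENNReal.ofReal_pow N.coe_nonneg,
                ENNReal.ofReal_coe_nnreal]
      exact (ENNReal.ofReal_le_ofReal_iff (by positivity)).1 h1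
    have herr := norm_sum_sum_le (S := S) (e := e) (D := N ^ 2 * |s|)
      (fun z => hsum (fun y => enorm_inner_sub_le hB y z) (tsum_weightedKernel_mul_le hcol hrow z))
      (fun y => hsum (fun z => enorm_inner_sub_le hB y z)
        (by simpa only [mul_comm] using tsum_weightedKernel_mul_le hcol hrow y)) v
    have hsplit : ∑ y ∈ S, ∑ z ∈ S,
        conj (v y) * v z * inner ℂ (B (basisVec y)) (B (basisVec z)) =
        (∑ y ∈ S, ∑ z ∈ S, conj (v y) * v z *
          ((inner ℂ (A (basisVec y)) (A (basisVec z)) - δ y z) * gaussianPhase s y z)) +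
        (∑ y ∈ S, ∑ z ∈ S, conj (v y) * v z * (δ y z * gaussianPhase s y z)) +
        ∑ y ∈ S, ∑ z ∈ S, conj (v y) * v z * e y z := by
      simp_rw [← Finset.sum_add_distrib]
      refine Finset.sum_congr rfl fun y _ => Finset.sum_congr rfl fun z _ => ?_
      simp only [e]
      ring
    rw [hform, hsplit, Complex.add_re, Complex.add_re,
      hδ v (fun y z => gaussianPhase s y z) (fun y => gaussianPhase_self s y)]
    have h1 := (abs_le.1 ((Complex.abs_re_le_norm _).trans herr)).1
    linarith
  have hlim : Filter.Tendsto (fun S : Finset Γ => ∑ y ∈ S, u y • basisVec y) Filter.atTop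
      (nhds u) := hasSum_basisVec u
  refine le_of_tendsto_of_tendsto ((hlim.norm.pow 2).const_mul _)
    (((B.continuous.tendsto u).comp hlim).norm.pow 2) (Filter.Eventually.of_forall fun S => ?_)
  simp only [Function.comp_apply]
  rw [norm_sum_basisVec_sq]
  exact hfin S u

/-! ### Families of compact sets with Lipschitz squared distances -/

section SqDistLipschitz

open Set

/-- A family of closed subsets of `[-R, R]` whose squared distances to the points of
`[-R - 1, R + 1]` vary in a Lipschitz way with the parameter. The squared distance from `c` to a
set is encoded through its lower bounds `r`. -/
structure SqDistLipschitz (σ : ℝ → Set ℝ) (R L : ℝ) : Prop where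
  isClosed : ∀ b, IsClosed (σ b)
  subset_Icc : ∀ b, σ b ⊆ Icc (-R) R
  radius_nonneg : 0 ≤ R
  const_pos : 0 < L
  sub_le_sq : ∀ b b', |b - b'| ≤ 1 → ∀ c, |c| ≤ R + 1 → ∀ r, (∀ l ∈ σ b', r ≤ (l - c) ^ 2) →
    ∀ l ∈ σ b, r - L * |b - b'| ≤ (l - c) ^ 2

/-- `(a, c)` is a bounded component of the complement of `s`. -/
def IsGapOf (s : Set ℝ) (a c : ℝ) : Prop :=
  a < c ∧ a ∈ s ∧ c ∈ s ∧ Disjoint (Ioo a c) s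

/-- The functions `em`, `ep` follow a gap of the family `σ` continuously over `J`. -/
def IsBranchOf (σ : ℝ → Set ℝ) (J : Set ℝ) (em ep : ℝ → ℝ) : Prop :=
  ContinuousOn em J ∧ ContinuousOn ep J ∧ ∀ b ∈ J, IsGapOf (σ b) (em b) (ep b)

lemma IsGapOf.eq_of_mem {s : Set ℝ} {a c a' c' m : ℝ} (h : IsGapOf s a c) (h' : IsGapOf s a' c')
    (hm : m ∈ Ioo a c) (hm' : m ∈ Ioo a' c') : a = a' ∧ c = c' := by
  obtain ⟨-, ha, hc, hd⟩ := h
  obtain ⟨-, ha', hc', hd'⟩ := h'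
  rw [Set.disjoint_left] at hd hd'
  refine ⟨le_antisymm ?_ ?_, le_antisymm ?_ ?_⟩ <;> by_contra! hlt
  · exact hd' ⟨hlt, hm.1.trans hm'.2⟩ ha
  · exact hd ⟨hlt, hm'.1.trans hm.2⟩ ha'
  · exact hd ⟨hm.1.trans hm'.2, hlt⟩ hc'
  · exact hd' ⟨hm'.1.trans hm.2, hlt⟩ hc

lemma IsBranchOf.mono {σ : ℝ → Set ℝ} {J J' : Set ℝ} {em ep : ℝ → ℝ} (h : IsBranchOf σ J em ep)
    (hJ : J' ⊆ J) : IsBranchOf σ J' em ep :=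
  ⟨h.1.mono hJ, h.2.1.mono hJ, fun b hb => h.2.2 b (hJ hb)⟩

/-- Two branches over a connected set that agree at one point agree everywhere: two gaps either
coincide or are disjoint, so the continuous function below, which is negative where the branches
agree and positive where they do not, cannot change sign. -/
lemma IsBranchOf.eqOn {σ : ℝ → Set ℝ} {J : Set ℝ} (hJ : IsPreconnected J)
    {em ep em' ep' : ℝ → ℝ} (h : IsBranchOf σ J em ep) (h' : IsBranchOf σ J em' ep') {x : ℝ}
    (hx : x ∈ J) (hm : em x = em' x) (hp : ep x = ep' x) : EqOn em em' J ∧ EqOn ep ep' J := by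
  let g : ℝ → ℝ := fun b => |em b - em' b| + |ep b - ep' b| -
    (min (ep b) (ep' b) - max (em b) (em' b))
  have hg : ContinuousOn g J :=
    (((h.1.sub h'.1).abs).add ((h.2.1.sub h'.2.1).abs)).sub
      ((h.2.1.inf h'.2.1).sub (h.1.sup h'.1))
  have hneg {b : ℝ} (hb : b ∈ J) (hm : em b = em' b) (hp : ep b = ep' b) : g b < 0 := by
    have := (h.2.2 b hb).1
    simp only [g, ← hm, ← hp, sub_self, abs_zero, min_self, max_self]
    linarith
  have hpos {b : ℝ} (hb : b ∈ J) (hne : ¬ (em b = em' b ∧ ep b = ep' b)) : 0 < g b := by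
    have h1 : min (ep b) (ep' b) ≤ max (em b) (em' b) := by
      by_contra! hlt
      obtain ⟨m, hm1, hm2⟩ := exists_between hlt
      rw [max_lt_iff] at hm1
      rw [lt_min_iff] at hm2
      exact hne ((h.2.2 b hb).eq_of_mem (h'.2.2 b hb) ⟨hm1.1, hm2.1⟩ ⟨hm1.2, hm2.2⟩)
    have h2 : 0 < |em b - em' b| + |ep b - ep' b| := by
      by_cases hm : em b = em' b
      · have : 0 < |ep b - ep' b| := abs_pos.2 (sub_ne_zero.2 fun hp => hne ⟨hm, hp⟩)
        positivity
      · have : 0 < |em b - em' b| := abs_pos.2 (sub_ne_zero.2 hm)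
        positivity
    simp only [g]
    linarith
  have hall : ∀ b ∈ J, em b = em' b ∧ ep b = ep' b := by
    intro b hb
    by_contra hne
    obtain ⟨y, hy, hy0⟩ := hJ.intermediate_value hx hb hg
      ⟨(hneg hx hm hp).le, (hpos hb hne).le⟩
    by_cases heq : em y = em' y ∧ ep y = ep' y
    · exact (hneg hy heq.1 heq.2).ne hy0
    · exact (hpos hy heq).ne' hy0
  exact ⟨fun b hb => (hall b hb).1, fun b hb => (hall b hb).2⟩

/-- `J` need not be open, so the intervals `[x₀, x]` need not be neighbourhoods within `J` of their
points; but near each point `J` is covered by two of them. -/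
lemma continuousOn_of_forall_uIcc {J : Set ℝ} {x₀ : ℝ} {f : ℝ → ℝ}
    (h : ∀ x ∈ J, ContinuousOn f (uIcc x₀ x)) : ContinuousOn f J := by
  refine continuousOn_of_locally_continuousOn fun b hb => ?_
  obtain ⟨q, hq, t, ht, hbt, htq⟩ : ∃ q ∈ J, ∃ t, IsOpen t ∧ b ∈ t ∧ ∀ x ∈ J ∩ t, x ≤ q := by
    by_cases hmax : ∃ q ∈ J, b < q
    · obtain ⟨q, hq, hbq⟩ := hmax
      exact ⟨q, hq, Iio q, isOpen_Iio, hbq, fun x hx => le_of_lt hx.2⟩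
    · push Not at hmax
      exact ⟨b, hb, univ, isOpen_univ, mem_univ _, fun x hx => hmax x hx.1⟩
  obtain ⟨p, hp, t', ht', hbt', htp⟩ : ∃ p ∈ J, ∃ t, IsOpen t ∧ b ∈ t ∧ ∀ x ∈ J ∩ t, p ≤ x := by
    by_cases hmin : ∃ p ∈ J, p < b
    · obtain ⟨p, hp, hbp⟩ := hmin
      exact ⟨p, hp, Ioi p, isOpen_Ioi, hbp, fun x hx => le_of_lt hx.2⟩
    · push Not at hmin
      exact ⟨b, hb, univ, isOpen_univ, mem_univ _, fun x hx => hmin x hx.1⟩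
  refine ⟨t ∩ t', ht.inter ht', ⟨hbt, hbt'⟩, ?_⟩
  refine ((h p hp).union_of_isClosed (h q hq) isClosed_Icc isClosed_Icc).mono ?_
  rintro x ⟨hxJ, hxt, hxt'⟩
  have h1 := htq x ⟨hxJ, hxt⟩
  have h2 := htp x ⟨hxJ, hxt'⟩
  rcases le_total x₀ x with hx | hx
  · exact Or.inr (mem_uIcc.2 (Or.inl ⟨hx, h1⟩))
  · exact Or.inl (mem_uIcc.2 (Or.inr ⟨h2, hx⟩))

namespace SqDistLipschitz

variable {σ : ℝ → Set ℝ} {R L : ℝ}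

lemma isCompact (h : SqDistLipschitz σ R L) (b : ℝ) : IsCompact (σ b) :=
  isCompact_Icc.of_isClosed_subset (h.isClosed b) (h.subset_Icc b)

lemma abs_le (h : SqDistLipschitz σ R L) {b l : ℝ} (hl : l ∈ σ b) : |l| ≤ R :=
  _root_.abs_le.2 (h.subset_Icc b hl)

lemma neg (h : SqDistLipschitz σ R L) : SqDistLipschitz (fun b => -σ b) R L where
  isClosed b := (h.isClosed b).neg
  subset_Icc b l hl := by
    have := h.subset_Icc b hl
    exact ⟨by linarith [this.2], by linarith [this.1]⟩
  radius_nonneg := h.radius_nonneg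
  const_pos := h.const_pos
  sub_le_sq b b' hb c hc r hr l hl := by
    have := h.sub_le_sq b b' hb (-c) (by rwa [abs_neg]) r (fun l' hl' => by
      have := hr (-l') (by simpa using hl')
      rwa [show (-l' - c) ^ 2 = (l' - -c) ^ 2 by ring] at this) (-l) hl
    rwa [show (-l - -c) ^ 2 = (l - c) ^ 2 by ring] at this

/-- The sets are `1 / 2`-Hölder continuous for the Hausdorff distance. -/
lemma exists_abs_sub_le (h : SqDistLipschitz σ R L) {ε : ℝ} (hε : 0 < ε) :
    ∃ δ > 0, ∀ b b', |b - b'| < δ → ∀ p ∈ σ b, ∃ q ∈ σ b', |p - q| ≤ ε := by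
  have hL := h.const_pos
  refine ⟨min 1 (ε ^ 2 / (2 * L)), by positivity, fun b b' hb p hp => ?_⟩
  rw [lt_min_iff, lt_div_iff₀ (by positivity)] at hb
  by_contra! hfar
  have hR := h.abs_le hp
  have := h.sub_le_sq b b' hb.1.le p (by linarith) (ε ^ 2) (fun l hl => by
    rw [← sq_abs (l - p), abs_sub_comm]
    exact pow_le_pow_left₀ hε.le (hfar l hl).le 2) p hp
  rw [sub_self] at this
  nlinarith

/-- From a point beyond all the sets, the distance is the distance to the upper edge, and it is
bounded below by `1`, so that taking the square root preserves the Lipschitz property. -/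
lemma sSup_sub_sSup_le (h : SqDistLipschitz σ R L) (hne : ∀ b, (σ b).Nonempty) {b b' : ℝ}
    (hb : |b - b'| ≤ 1) : sSup (σ b) - sSup (σ b') ≤ L * |b - b'| := by
  have hL := h.const_pos
  have hR := h.radius_nonneg
  have hE := (h.isCompact b).sSup_mem (hne b)
  have hE' := (h.isCompact b').sSup_mem (hne b')
  have h1 := (h.subset_Icc b hE).2
  have h2 := (h.subset_Icc b' hE').2
  have h3 := h.sub_le_sq b b' hb (R + 1) (by rw [abs_of_nonneg (by linarith)])
    ((R + 1 - sSup (σ b')) ^ 2) (fun l hl => by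
      have h4 := le_csSup (h.isCompact b').bddAbove hl
      nlinarith) _ hE
  by_contra! hlt
  have h5 : 0 ≤ L * |b - b'| := by positivity
  nlinarith

lemma lipschitzWith_of_abs_sub_le {f : ℝ → ℝ} {M R : ℝ} (hM : 0 ≤ M) (hf : ∀ b, |f b| ≤ R)
    (hR : 0 ≤ R) (hlip : ∀ b b', |b - b'| ≤ 1 → f b - f b' ≤ M * |b - b'|) :
    LipschitzWith (M + 2 * R).toNNReal f := by
  refine LipschitzWith.of_dist_le_mul fun b b' => ?_
  rw [Real.coe_toNNReal _ (by positivity), Real.dist_eq, Real.dist_eq]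
  rcases le_total |b - b'| 1 with hb | hb
  · have h1 := hlip b b' hb
    have h2 := hlip b' b (by rwa [abs_sub_comm])
    rw [abs_sub_comm b' b] at h2
    rw [abs_sub_le_iff]
    constructor <;> nlinarith [abs_nonneg (b - b')]
  · calc |f b - f b'| ≤ |f b| + |f b'| := abs_sub _ _
      _ ≤ 2 * R * 1 := by linarith [hf b, hf b']
      _ ≤ (M + 2 * R) * |b - b'| := by
          gcongr
          linarith

lemma lipschitzWith_sSup (h : SqDistLipschitz σ R L) (hne : ∀ b, (σ b).Nonempty) :
    LipschitzWith (L + 2 * R).toNNReal fun b => sSup (σ b) :=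
  lipschitzWith_of_abs_sub_le h.const_pos.le
    (fun b => h.abs_le ((h.isCompact b).sSup_mem (hne b))) h.radius_nonneg
    fun _ _ => h.sSup_sub_sSup_le hne

lemma lipschitzWith_sInf (h : SqDistLipschitz σ R L) (hne : ∀ b, (σ b).Nonempty) :
    LipschitzWith (L + 2 * R).toNNReal fun b => sInf (σ b) := by
  simp_rw [Real.sInf_def]
  exact (h.neg.lipschitzWith_sSup fun b => (hne b).neg).neg

/-- A point at distance `q` from `c` moves to a point at distance less than `q + ρ`. -/
lemma exists_abs_sub_lt (h : SqDistLipschitz σ R L) {b b' c l ρ : ℝ} (hb : |b - b'| ≤ 1)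
    (hc : |c| ≤ R + 1) (hl : l ∈ σ b') (hρ : 0 < ρ) (hLρ : L * |b - b'| ≤ 2 * |l - c| * ρ) :
    ∃ l' ∈ σ b, |l' - c| < |l - c| + ρ := by
  by_contra! hfar
  have := h.sub_le_sq b' b (by rwa [abs_sub_comm]) c hc ((|l - c| + ρ) ^ 2) (fun l' hl' => by
    rw [← sq_abs (l' - c)]
    exact pow_le_pow_left₀ (by positivity) (hfar l' hl') 2) l hl
  rw [abs_sub_comm b' b, ← sq_abs (l - c)] at this
  nlinarith

/-- A gap of width at least `w` persists over a distance which depends on `w` only, and its edges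
move at most at the speed `2 L / w`. The middle of the gap controls the interior, and
the points at distance `w / 4` from each edge, for which that edge is the nearest point, control
the edges. -/
lemma exists_gap_near (h : SqDistLipschitz σ R L) {w : ℝ} (hw : 0 < w) {b b' a c : ℝ}
    (hgap : IsGapOf (σ b') a c) (hac : w ≤ c - a) (hb : |b - b'| < min 1 (w ^ 2 / (16 * L))) :
    ∃ a' c', IsGapOf (σ b) a' c' ∧ |a' - a| ≤ 2 * L / w * |b - b'| ∧
      |c' - c| ≤ 2 * L / w * |b - b'| ∧ a' < (a + c) / 2 ∧ (a + c) / 2 < c' := by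
  have hL := h.const_pos
  obtain ⟨hlt, ha, hc, hd⟩ := id hgap
  rw [Set.disjoint_left] at hd
  rcases eq_or_ne b b' with rfl | hne
  · refine ⟨a, c, hgap, ?_, ?_, ?_, ?_⟩
    · simp
    · simp
    · linarith
    · linarith
  have ht : 0 < |b - b'| := abs_pos.2 (sub_ne_zero.2 hne)
  rw [lt_min_iff, lt_div_iff₀ (by positivity)] at hb
  set ρ := 2 * L / w * |b - b'| with hρ
  have hwρ : w * ρ = 2 * (L * |b - b'|) := by
    rw [hρ]
    field_simp
  have hρ0 : 0 < ρ := by positivity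
  have hρw : ρ < w / 8 := by
    by_contra! hge
    nlinarith
  have hRa := _root_.abs_le.1 (h.abs_le ha)
  have hRc := _root_.abs_le.1 (h.abs_le hc)
  have hcen {y : ℝ} (h1 : a ≤ y) (h2 : y ≤ c) : |y| ≤ R + 1 :=
    _root_.abs_le.2 ⟨by linarith, by linarith⟩
  have hfree : ∀ l ∈ σ b, l ≤ a + ρ ∨ c - ρ ≤ l := by
    intro l hl
    by_contra! hl'
    have h1 := h.sub_le_sq b b' hb.1.le ((a + c) / 2) (hcen (by linarith) (by linarith))
      (((c - a) / 2) ^ 2) (fun l' hl' => by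
        rcases le_or_gt l' a with h2 | h2
        · nlinarith
        · rcases le_or_gt c l' with h3 | h3
          · nlinarith
          · exact absurd hl' (hd ⟨h2, h3⟩)) l hl
    have h2 : (l - (a + c) / 2) ^ 2 < ((c - a) / 2 - ρ) ^ 2 :=
      sq_lt_sq' (by linarith) (by linarith)
    nlinarith
  obtain ⟨l₁, hl₁, hl₁'⟩ : ∃ l ∈ σ b, |l - (a + w / 4)| < w / 4 + ρ := by
    have h1 : |a - (a + w / 4)| = w / 4 := by
      rw [abs_sub_comm, add_sub_cancel_left, abs_of_pos (by positivity)]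
    have := h.exists_abs_sub_lt hb.1.le (hcen (y := a + w / 4) (by linarith) (by linarith)) ha hρ0
      (by rw [h1]; linarith)
    rwa [h1] at this
  obtain ⟨l₂, hl₂, hl₂'⟩ : ∃ l ∈ σ b, |l - (c - w / 4)| < w / 4 + ρ := by
    have h1 : |c - (c - w / 4)| = w / 4 := by
      rw [sub_sub_cancel, abs_of_pos (by positivity)]
    have := h.exists_abs_sub_lt hb.1.le (hcen (y := c - w / 4) (by linarith) (by linarith)) hc hρ0
      (by rw [h1]; linarith)
    rwa [h1] at this
  rw [abs_lt] at hl₁' hl₂'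
  have hl₁a : l₁ ≤ a + ρ := (hfree l₁ hl₁).resolve_right (by linarith)
  have hl₂c : c - ρ ≤ l₂ := (hfree l₂ hl₂).resolve_left (by linarith)
  obtain ⟨a', ⟨ha', ham⟩, hamax⟩ := ((h.isCompact b).inter_right
    (isClosed_Iic (a := (a + c) / 2))).exists_isGreatest
      ⟨l₁, hl₁, by rw [mem_Iic]; linarith⟩
  obtain ⟨c', ⟨hc', hcm⟩, hcmin⟩ := ((h.isCompact b).inter_right
    (isClosed_Ici (a := (a + c) / 2))).exists_isLeast
      ⟨l₂, hl₂, by rw [mem_Ici]; linarith⟩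
  rw [mem_Iic] at ham
  rw [mem_Ici] at hcm
  have h1 : l₁ ≤ a' := hamax ⟨hl₁, by rw [mem_Iic]; linarith⟩
  have h2 : c' ≤ l₂ := hcmin ⟨hl₂, by rw [mem_Ici]; linarith⟩
  have h3 : a' ≤ a + ρ := (hfree a' ha').resolve_right (by linarith)
  have h4 : c - ρ ≤ c' := (hfree c' hc').resolve_left (by linarith)
  refine ⟨a', c', ⟨by linarith, ha', hc', ?_⟩, ?_, ?_, by linarith, by linarith⟩
  · rw [Set.disjoint_left]
    rintro x ⟨hx1, hx2⟩ hx
    rcases le_total x ((a + c) / 2) with h5 | h5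
    · exact absurd (hamax ⟨hx, h5⟩) (not_le.2 hx1)
    · exact absurd (hcmin ⟨hx, h5⟩) (not_le.2 hx2)
  · exact _root_.abs_le.2 ⟨by linarith, by linarith⟩
  · exact _root_.abs_le.2 ⟨by linarith, by linarith⟩

/-- The edges of the gap around a fixed point depend continuously on the parameter. -/
lemma isBranchOf_of_mem (h : SqDistLipschitz σ R L) {U : Set ℝ} {em ep : ℝ → ℝ} {m : ℝ}
    (hgap : ∀ b ∈ U, IsGapOf (σ b) (em b) (ep b)) (hm : ∀ b ∈ U, m ∈ Ioo (em b) (ep b)) :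
    IsBranchOf σ U em ep := by
  have hL := h.const_pos
  have key (b : ℝ) (hb : b ∈ U) : ContinuousWithinAt em U b ∧ ContinuousWithinAt ep U b := by
    have hw : 0 < ep b - em b := sub_pos.2 (hgap b hb).1
    have hlim : Filter.Tendsto (fun x => 2 * L / (ep b - em b) * |x - b|) (nhdsWithin b U)
        (nhds 0) := by
      have : Continuous fun x => 2 * L / (ep b - em b) * |x - b| := by fun_prop
      simpa using (this.tendsto b).mono_left nhdsWithin_le_nhds
    have hdist : Filter.Tendsto (fun x => |x - b|) (nhdsWithin b U) (nhds 0) := by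
      have : Continuous fun x => |x - b| := by fun_prop
      simpa using (this.tendsto b).mono_left nhdsWithin_le_nhds
    have hev : ∀ᶠ x in nhdsWithin b U, |em x - em b| ≤ 2 * L / (ep b - em b) * |x - b| ∧
        |ep x - ep b| ≤ 2 * L / (ep b - em b) * |x - b| := by
      filter_upwards [self_mem_nhdsWithin,
        hdist.eventually_lt_const (show 0 < min 1 ((ep b - em b) ^ 2 / (16 * L)) by positivity),
        hlim.eventually_lt_const (sub_pos.2 (hm b hb).1),
        hlim.eventually_lt_const (sub_pos.2 (hm b hb).2)] with x hxU hx1 hx2 hx3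
      obtain ⟨a', c', hg, ha', hc', -, -⟩ := h.exists_gap_near hw (hgap b hb) le_rfl hx1
      have h1 := _root_.abs_le.1 ha'
      have h2 := _root_.abs_le.1 hc'
      obtain ⟨e1, e2⟩ := (hgap x hxU).eq_of_mem hg (hm x hxU) ⟨by linarith, by linarith⟩
      rw [e1, e2]
      exact ⟨ha', hc'⟩
    constructor
    · refine tendsto_iff_dist_tendsto_zero.2 (squeeze_zero' ?_ (hev.mono fun x hx => hx.1) hlim)
      exact Filter.Eventually.of_forall fun _ => dist_nonneg
    · refine tendsto_iff_dist_tendsto_zero.2 (squeeze_zero' ?_ (hev.mono fun x hx => hx.2) hlim)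
      exact Filter.Eventually.of_forall fun _ => dist_nonneg
  exact ⟨fun b hb => (key b hb).1, fun b hb => (key b hb).2, hgap⟩

lemma exists_branch_near (h : SqDistLipschitz σ R L) {w : ℝ} (hw : 0 < w) {x a c : ℝ}
    (hgap : IsGapOf (σ x) a c) (hac : w ≤ c - a) :
    ∃ em ep : ℝ → ℝ, em x = a ∧ ep x = c ∧
      IsBranchOf σ (Metric.ball x (min 1 (w ^ 2 / (16 * L)))) em ep ∧
      ∀ b ∈ Metric.ball x (min 1 (w ^ 2 / (16 * L))),
        |em b - a| ≤ 2 * L / w * |b - x| ∧ |ep b - c| ≤ 2 * L / w * |b - x| := by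
  have hL := h.const_pos
  have hex : ∀ b ∈ Metric.ball x (min 1 (w ^ 2 / (16 * L))), ∃ a' c', IsGapOf (σ b) a' c' ∧
      |a' - a| ≤ 2 * L / w * |b - x| ∧ |c' - c| ≤ 2 * L / w * |b - x| ∧
      a' < (a + c) / 2 ∧ (a + c) / 2 < c' :=
    fun b hb => h.exists_gap_near hw hgap hac (by simpa [Real.dist_eq] using hb)
  choose! em ep hg hm hp h1 h2 using hex
  have hx : x ∈ Metric.ball x (min 1 (w ^ 2 / (16 * L))) :=
    Metric.mem_ball_self (by positivity)
  refine ⟨em, ep, ?_, ?_, h.isBranchOf_of_mem hg fun b hb => ⟨h1 b hb, h2 b hb⟩,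
    fun b hb => ⟨hm b hb, hp b hb⟩⟩
  · have := hm x hx
    rw [sub_self, abs_zero, mul_zero] at this
    exact sub_eq_zero.1 (abs_nonpos_iff.1 this)
  · have := hp x hx
    rw [sub_self, abs_zero, mul_zero] at this
    exact sub_eq_zero.1 (abs_nonpos_iff.1 this)

/-- A branch over `[x₀, x]` extends beyond `x` by a distance depending only on a lower bound for the
width of the gap at `x`. -/
lemma exists_branch_extension (h : SqDistLipschitz σ R L) {w : ℝ} (hw : 0 < w) {x₀ x y : ℝ}
    {em ep : ℝ → ℝ} (hbr : IsBranchOf σ (uIcc x₀ x) em ep) (hwx : w ≤ ep x - em x)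
    (hx : x ∈ uIcc x₀ y) (hxy : |y - x| < min 1 (w ^ 2 / (16 * L))) :
    ∃ em' ep', em' x₀ = em x₀ ∧ ep' x₀ = ep x₀ ∧ IsBranchOf σ (uIcc x₀ y) em' ep' := by
  classical
  obtain ⟨fm, fp, hfm, hfp, hf, -⟩ :=
    h.exists_branch_near hw (hbr.2.2 x right_mem_uIcc) hwx
  have hsub : uIcc x y ⊆ Metric.ball x (min 1 (w ^ 2 / (16 * L))) := by
    intro z hz
    rw [Metric.mem_ball, Real.dist_eq]
    exact (abs_sub_left_of_mem_uIcc hz).trans_lt hxy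
  replace hf := hf.mono hsub
  have hcover : uIcc x₀ y ⊆ uIcc x₀ x ∪ uIcc x y := uIcc_subset_uIcc_union_uIcc
  have hinter {z : ℝ} (hz : z ∈ uIcc x₀ x) (hz' : z ∈ uIcc x y) : z = x := by
    rw [mem_uIcc] at hx hz hz'
    rcases hx with hx | hx <;> rcases hz with hz | hz <;> rcases hz' with hz' | hz' <;> linarith
  have hglue {f g : ℝ → ℝ} (hf : ContinuousOn f (uIcc x₀ x)) (hg : ContinuousOn g (uIcc x y))
      (hfg : g x = f x) :
      ContinuousOn (fun z => if z ∈ uIcc x₀ x then f z else g z) (uIcc x₀ y) := by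
    refine (ContinuousOn.union_of_isClosed (hf.congr fun z hz => if_pos hz)
      (hg.congr fun z hz => ?_) isClosed_Icc isClosed_Icc).mono hcover
    split_ifs with hz'
    · rw [hinter hz' hz, hfg]
    · rfl
  refine ⟨fun z => if z ∈ uIcc x₀ x then em z else fm z,
    fun z => if z ∈ uIcc x₀ x then ep z else fp z, if_pos left_mem_uIcc, if_pos left_mem_uIcc,
    hglue hbr.1 hf.1 hfm, hglue hbr.2.1 hf.2.1 hfp, fun z hz => ?_⟩
  dsimp only
  split_ifs with hz'
  · exact hbr.2.2 z hz'
  · exact hf.2.2 z ((hcover hz).resolve_left hz')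

/-- A gap whose width stays away from zero wherever it can be followed can be followed over the
whole interval, and its edges are Lipschitz. By uniqueness, the branches over the intervals
`[b₀, x]` fit together to a maximal one; its width is bounded below, so it extends by steps of
constant length. -/
theorem exists_lipschitz_branch (h : SqDistLipschitz σ R L) {b₀ a c : ℝ}
    (hgap : IsGapOf (σ b₀) a c) {I : Set ℝ} (hI : I.OrdConnected) (hb₀ : b₀ ∈ I)
    (hopen : ∀ J : Set ℝ, J ⊆ I → J.OrdConnected → b₀ ∈ J →
      ∀ em ep : ℝ → ℝ, em b₀ = a → ep b₀ = c → IsBranchOf σ J em ep →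
        ∃ w : ℝ, 0 < w ∧ ∀ b ∈ J, w ≤ ep b - em b) :
    ∃ em ep : ℝ → ℝ, em b₀ = a ∧ ep b₀ = c ∧ (∀ b ∈ I, IsGapOf (σ b) (em b) (ep b)) ∧
      ∃ C : ℝ≥0, LipschitzOnWith C em I ∧ LipschitzOnWith C ep I := by
  have hL := h.const_pos
  let Reach (x : ℝ) : Prop :=
    ∃ em ep : ℝ → ℝ, em b₀ = a ∧ ep b₀ = c ∧ IsBranchOf σ (uIcc b₀ x) em ep
  have hreach_mono {x y : ℝ} (hx : Reach x) (hy : y ∈ uIcc b₀ x) : Reach y := by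
    obtain ⟨em, ep, h1, h2, h3⟩ := hx
    exact ⟨em, ep, h1, h2, h3.mono (uIcc_subset_uIcc_left hy)⟩
  have hreach_self : Reach b₀ := by
    refine ⟨fun _ => a, fun _ => c, rfl, rfl, continuousOn_const, continuousOn_const, ?_⟩
    intro b hb
    rw [uIcc_self, mem_singleton_iff] at hb
    rwa [hb]
  have hR : ∀ x, Reach x → Reach x := fun _ hx => hx
  choose! fm fp hfm hfp hf using hR
  have hagree {x y : ℝ} (hx : Reach x) (hy : y ∈ uIcc b₀ x) :
      fm y y = fm x y ∧ fp y y = fp x y := by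
    have hy' := hreach_mono hx hy
    have := (hf y hy').eqOn isPreconnected_uIcc ((hf x hx).mono (uIcc_subset_uIcc_left hy))
      left_mem_uIcc (by rw [hfm y hy', hfm x hx]) (by rw [hfp y hy', hfp x hx])
    exact ⟨this.1 right_mem_uIcc, this.2 right_mem_uIcc⟩
  let em (x : ℝ) : ℝ := fm x x
  let ep (x : ℝ) : ℝ := fp x x
  have hbr {x : ℝ} (hx : Reach x) : IsBranchOf σ (uIcc b₀ x) em ep :=
    ⟨(hf x hx).1.congr fun y hy => (hagree hx hy).1,
      (hf x hx).2.1.congr fun y hy => (hagree hx hy).2,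
      fun y hy => (hf y (hreach_mono hx hy)).2.2 y right_mem_uIcc⟩
  let J : Set ℝ := {x | x ∈ I ∧ Reach x}
  have hJconn : J.OrdConnected := by
    refine ⟨fun x hx y hy z hz => ⟨hI.out hx.1 hy.1 hz, ?_⟩⟩
    rcases le_total b₀ z with hz' | hz'
    · exact hreach_mono hy.2 (mem_uIcc.2 (Or.inl ⟨hz', hz.2⟩))
    · exact hreach_mono hx.2 (mem_uIcc.2 (Or.inr ⟨hz.1, hz'⟩))
  have hJbr : IsBranchOf σ J em ep :=
    ⟨continuousOn_of_forall_uIcc fun x hx => (hbr hx.2).1,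
      continuousOn_of_forall_uIcc fun x hx => (hbr hx.2).2.1,
      fun x hx => (hbr hx.2).2.2 x right_mem_uIcc⟩
  have hem : em b₀ = a := hfm b₀ hreach_self
  have hep : ep b₀ = c := hfp b₀ hreach_self
  obtain ⟨w, hw, hwJ⟩ := hopen J (fun x hx => hx.1) hJconn ⟨hb₀, hreach_self⟩ em ep hem hep hJbr
  set δ := min 1 (w ^ 2 / (16 * L)) with hδ
  have hδ0 : 0 < δ := by positivity
  have hsteps (n : ℕ) : ∀ y ∈ I, |y - b₀| ≤ n * (δ / 2) → y ∈ J := by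
    induction n with
    | zero =>
      intro y _ hy
      rw [Nat.cast_zero, zero_mul, abs_nonpos_iff, sub_eq_zero] at hy
      rw [hy]
      exact ⟨hb₀, hreach_self⟩
    | succ n ih =>
      intro y hy hyn
      push_cast at hyn
      -- A point of `[b₀, y]` within `n δ / 2` of `b₀` and within `δ / 2` of `y`.
      set x := b₀ + (y - b₀) * (n / (n + 1)) with hx
      have hn0 : (0 : ℝ) ≤ n / (n + 1) := by positivity
      have hn1 : (n : ℝ) / (n + 1) ≤ 1 := (div_le_one (by positivity)).2 (by linarith)
      have hxy : x ∈ uIcc b₀ y := by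
        rw [mem_uIcc]
        rcases le_total b₀ y with h1 | h1
        · left
          constructor <;> nlinarith
        · right
          constructor <;> nlinarith
      have hx1 : |x - b₀| ≤ n * (δ / 2) := by
        rw [hx, add_sub_cancel_left, abs_mul, abs_of_nonneg hn0, mul_div_assoc',
          div_le_iff₀ (by positivity)]
        nlinarith [mul_le_mul_of_nonneg_right hyn (Nat.cast_nonneg (α := ℝ) n)]
      have hx2 : |y - x| < δ := by
        have h1 : y - x = (y - b₀) / (n + 1) := by
          rw [hx]
          field_simp
          ring
        rw [h1, abs_div, abs_of_pos (by positivity : (0 : ℝ) < n + 1), div_lt_iff₀ (by positivity)]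
        nlinarith [Nat.cast_nonneg (α := ℝ) n]
      have hxI : x ∈ I := hI.uIcc_subset hb₀ hy hxy
      have hxJ := ih x hxI hx1
      obtain ⟨em', ep', h1, h2, h3⟩ :=
        h.exists_branch_extension hw (hbr hxJ.2) (hwJ x hxJ) hxy hx2
      exact ⟨hy, em', ep', h1.trans hem, h2.trans hep, h3⟩
  have hall : ∀ y ∈ I, y ∈ J := by
    intro y hy
    obtain ⟨n, hn⟩ := exists_nat_ge (|y - b₀| / (δ / 2))
    exact hsteps n y hy ((div_le_iff₀ (by positivity)).1 hn)
  have hIbr : IsBranchOf σ I em ep := hJbr.mono hall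
  refine ⟨em, ep, hem, hep, hIbr.2.2, (2 * L / w + 2 * R / δ).toNNReal, ?_⟩
  have hRn := h.radius_nonneg
  have hlip : ∀ x ∈ I, ∀ y ∈ I, |em x - em y| ≤ (2 * L / w + 2 * R / δ) * |x - y| ∧
      |ep x - ep y| ≤ (2 * L / w + 2 * R / δ) * |x - y| := by
    intro x hx y hy
    rcases lt_or_ge |x - y| δ with hxy | hxy
    · obtain ⟨gm, gp, hgm, hgp, hg, hgle⟩ :=
        h.exists_branch_near hw (hIbr.2.2 y hy) (hwJ y (hall y hy))
      have hsub : uIcc y x ⊆ Metric.ball y δ := by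
        intro z hz
        rw [Metric.mem_ball, Real.dist_eq]
        exact (abs_sub_left_of_mem_uIcc hz).trans_lt hxy
      have heq := (hIbr.mono (hI.uIcc_subset hy hx)).eqOn isPreconnected_uIcc (hg.mono hsub)
        left_mem_uIcc hgm.symm hgp.symm
      have h1 := hgle x (hsub right_mem_uIcc)
      rw [← heq.1 right_mem_uIcc, ← heq.2 right_mem_uIcc] at h1
      have h2 : 2 * L / w * |x - y| ≤ (2 * L / w + 2 * R / δ) * |x - y| := by
        gcongr
        exact le_add_of_nonneg_right (by positivity)
      exact ⟨h1.1.trans h2, h1.2.trans h2⟩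
    · have hfar : 2 * R ≤ (2 * L / w + 2 * R / δ) * |x - y| :=
        calc 2 * R = 2 * R / δ * δ := by field_simp
          _ ≤ (2 * L / w + 2 * R / δ) * |x - y| := by
            gcongr
            exact le_add_of_nonneg_left (by positivity)
      have hx' := hIbr.2.2 x hx
      have hy' := hIbr.2.2 y hy
      constructor
      · refine (abs_sub _ _).trans (le_trans ?_ hfar)
        linarith [h.abs_le hx'.2.1, h.abs_le hy'.2.1]
      · refine (abs_sub _ _).trans (le_trans ?_ hfar)
        linarith [h.abs_le hx'.2.2.1, h.abs_le hy'.2.2.1]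
  have hC : 0 ≤ 2 * L / w + 2 * R / δ := by positivity
  constructor
  · refine LipschitzOnWith.of_dist_le_mul fun x hx y hy => ?_
    rw [Real.coe_toNNReal _ hC]
    exact (hlip x hx y hy).1
  · refine LipschitzOnWith.of_dist_le_mul fun x hx y hy => ?_
    rw [Real.coe_toNNReal _ hC]
    exact (hlip x hx y hy).2

end SqDistLipschitz

end SqDistLipschitz

/-! ### Lattice sums -/

/-- The lattice sum `∑ ⟨x - x'⟩^(-2β)` is bounded uniformly in `x'`: after a shift by `F x'`, the
injection `F` compares it with the sum over the integer lattice. -/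
lemma exists_tsum_rpow_le (hΓ : IsIrregularLattice Γ) {β : ℝ} (hβ : 1 < β) :
    ∃ N : ℝ≥0, ∀ x' : Γ,
      ∑' x : Γ, ENNReal.ofReal ((1 + ‖(x : Plane) - x'‖ ^ 2) ^ (-β)) ≤ N := by
  classical
  obtain ⟨F, hinj, hF⟩ := hΓ
  let g (n : Fin 2 → ℤ) : ℝ≥0∞ :=
    ENNReal.ofReal (2 ^ β * ‖n‖ ^ (-(2 * β))) + if n = 0 then 1 else 0
  have hg : ∑' n, g n ≠ ∞ := by
    have h1 : Summable fun n : Fin 2 → ℤ => 2 ^ β * ‖n‖ ^ (-(2 * β)) :=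
      (EisensteinSeries.summable_one_div_norm_rpow (by linarith)).mul_left _
    rw [ENNReal.tsum_add, tsum_ite_eq]
    exact ENNReal.add_ne_top.2 ⟨h1.tsum_ofReal_ne_top, ENNReal.one_ne_top⟩
  refine ⟨(∑' n, g n).toNNReal, fun x' => ?_⟩
  rw [ENNReal.coe_toNNReal hg]
  have hinj' : Function.Injective fun x : Γ => F x - F x' := fun x y hxy =>
    hinj (sub_left_injective hxy)
  refine le_trans (ENNReal.tsum_le_tsum fun x => ?_) (ENNReal.tsum_comp_le_tsum_of_injective hinj' g)
  set p := 1 + ‖(x : Plane) - x'‖ ^ 2 with hp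
  have hp1 : 1 ≤ p := le_add_of_nonneg_right (sq_nonneg _)
  by_cases hn : F x - F x' = 0
  · simp only [g, hn, if_true]
    refine le_trans ?_ le_add_self
    rw [ENNReal.ofReal_le_one]
    exact Real.rpow_le_one_of_one_le_of_nonpos hp1 (by linarith)
  · refine le_trans (ENNReal.ofReal_le_ofReal ?_) le_self_add
    have h1 : ‖F x - F x'‖ ≤ ‖(x : Plane) - x'‖ + 1 := by
      refine (pi_norm_le_iff_of_nonneg (by positivity)).2 fun i => ?_
      have h2 : ‖(F x - F x') i‖ = ‖(WithLp.toLp 2 (fun i => (F x i : ℝ)) -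
          WithLp.toLp 2 (fun i => (F x' i : ℝ)) : Plane) i‖ := by
        simp [Int.norm_eq_abs]
      have h3 : (WithLp.toLp 2 (fun i => (F x i : ℝ)) - WithLp.toLp 2 (fun i => (F x' i : ℝ)) :
          Plane) = (x - x') + ((WithLp.toLp 2 (fun i => (F x i : ℝ)) - (x : Plane)) -
            (WithLp.toLp 2 (fun i => (F x' i : ℝ)) - (x' : Plane))) := by
        abel
      rw [h2]
      refine (PiLp.norm_apply_le _ i).trans ?_
      rw [h3]
      refine (norm_add_le _ _).trans ?_
      have h4 := norm_sub_le (WithLp.toLp 2 (fun i => (F x i : ℝ)) - (x : Plane))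
            (WithLp.toLp 2 (fun i => (F x' i : ℝ)) - (x' : Plane))
      linarith [hF x, hF x']
    have h0 : 0 < ‖F x - F x'‖ := norm_pos_iff.2 hn
    have h2 : ‖F x - F x'‖ ^ 2 / 2 ≤ p := by
      have := pow_le_pow_left₀ h0.le h1 2
      nlinarith [sq_nonneg (‖(x : Plane) - x'‖ - 1)]
    calc p ^ (-β) ≤ (‖F x - F x'‖ ^ 2 / 2) ^ (-β) :=
          Real.rpow_le_rpow_of_nonpos (by positivity) h2 (by linarith)
      _ = 2 ^ β * ‖F x - F x'‖ ^ (-(2 * β)) := by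
          rw [Real.div_rpow (by positivity) (by norm_num), ← Real.rpow_natCast,
            ← Real.rpow_mul h0.le, Real.rpow_neg (by norm_num : (0 : ℝ) ≤ 2), div_inv_eq_mul,
            mul_comm]
          congr 2
          push_cast
          ring

/-- For `α > 3` the `ℓ²` bound with weight `⟨x⟩^(2α)` controls the Schur norm with the quadratic
weight, because `⟨x⟩^(4 - 2α)` is summable over the lattice. -/
lemma exists_tsum_weight_mul_le (hΓ : IsIrregularLattice Γ) {α : ℝ} (hα : 3 < α) (M : ℝ≥0) :
    ∃ N : ℝ≥0, ∀ k : Γ → Γ → ℂ, hNorm α k ≤ M → ∀ x' : Γ,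
      ∑' x : Γ, ENNReal.ofReal (1 + ‖(x : Plane) - x'‖ ^ 2) * ‖k x x'‖ₑ ≤ N := by
  obtain ⟨N, hN⟩ := exists_tsum_rpow_le hΓ (β := α - 2) (by linarith)
  refine ⟨M ^ 2 + N, fun k hk x' => ?_⟩
  have hcol : ∑' x : Γ, ENNReal.ofReal (weight (2 * α) ((x : Plane) - x') * ‖k x x'‖ ^ 2) ≤
      (M : ℝ≥0∞) ^ 2 := by
    have h1 := (le_iSup (fun x' : Γ => (∑' x : Γ, ENNReal.ofReal
      (weight (2 * α) ((x : Plane) - (x' : Plane)) * ‖k x x'‖ ^ 2)) ^ (1 / 2 : ℝ)) x').trans hk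
    have h2 := pow_le_pow_left₀ zero_le h1 2
    rwa [← ENNReal.rpow_natCast, ← ENNReal.rpow_mul, Nat.cast_ofNat,
      one_div_mul_cancel two_ne_zero, ENNReal.rpow_one] at h2
  calc ∑' x : Γ, ENNReal.ofReal (1 + ‖(x : Plane) - x'‖ ^ 2) * ‖k x x'‖ₑ
      ≤ ∑' x : Γ, (ENNReal.ofReal (weight (2 * α) ((x : Plane) - x') * ‖k x x'‖ ^ 2) +
          ENNReal.ofReal ((1 + ‖(x : Plane) - x'‖ ^ 2) ^ (-(α - 2)))) := by
        refine ENNReal.tsum_le_tsum fun x => ?_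
        rw [weight, ← ofReal_norm, ← ENNReal.ofReal_mul (by positivity),
          ← ENNReal.ofReal_add (by positivity) (by positivity)]
        refine ENNReal.ofReal_le_ofReal ?_
        set p := 1 + ‖(x : Plane) - x'‖ ^ 2 with hp
        have hp0 : 0 < p := by positivity
        have h1 : p ^ (2 * α / 2) = (p ^ (α / 2)) ^ 2 := by
          rw [← Real.rpow_natCast, ← Real.rpow_mul hp0.le]
          congr 1
          push_cast
          ring
        have h2 : p ^ (-(α - 2)) = (p ^ (1 - α / 2)) ^ 2 := by
          rw [← Real.rpow_natCast, ← Real.rpow_mul hp0.le]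
          congr 1
          push_cast
          ring
        have h3 : p * ‖k x x'‖ = p ^ (α / 2) * ‖k x x'‖ * p ^ (1 - α / 2) := by
          have : p ^ (α / 2) * p ^ (1 - α / 2) = p := by
            rw [← Real.rpow_add hp0, add_sub_cancel, Real.rpow_one]
          linear_combination -‖k x x'‖ * this
        rw [h1, h2, h3, ← mul_pow]
        have h4 : 0 ≤ p ^ (α / 2) * ‖k x x'‖ * p ^ (1 - α / 2) := by positivity
        linarith [two_mul_le_add_sq (p ^ (α / 2) * ‖k x x'‖) (p ^ (1 - α / 2))]
    _ ≤ ((M ^ 2 + N : ℝ≥0) : ℝ≥0∞) := by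
        rw [ENNReal.tsum_add]
        push_cast
        exact add_le_add hcol (hN x')

/-! ### Spectra of magnetic operators -/

lemma enorm_magneticKernel (b : ℝ) (k : Γ → Γ → ℂ) (x y : Γ) :
    ‖magneticKernel b k x y‖ₑ = ‖k x y‖ₑ := by
  rw [magneticKernel, enorm_mul, ← ofReal_norm, mul_comm Complex.I, Complex.norm_exp_ofReal_mul_I,
    ENNReal.ofReal_one, one_mul]

lemma magneticKernel_symm {b : ℝ} {k : Γ → Γ → ℂ} (hk : ∀ x y, k x y = star (k y x)) (x y : Γ) :
    magneticKernel b k x y = star (magneticKernel b k y x) := by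
  rw [magneticKernel, magneticKernel, star_mul', ← hk x y, flux_swap (x : Plane),
    ← starRingEnd_apply, ← Complex.exp_conj, map_mul, Complex.conj_I, Complex.conj_ofReal]
  congr 2
  push_cast
  ring

lemma tsum_enorm_le_of_weight {k : Γ → Γ → ℂ} {N : ℝ≥0∞} {x' : Γ}
    (h : ∑' x : Γ, ENNReal.ofReal (1 + ‖(x : Plane) - x'‖ ^ 2) * ‖k x x'‖ₑ ≤ N) :
    ∑' x : Γ, ‖k x x'‖ₑ ≤ N := by
  refine le_trans (ENNReal.tsum_le_tsum fun x => ?_) h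
  refine le_mul_of_one_le_left zero_le ?_
  rw [ENNReal.one_le_ofReal]
  exact le_add_of_nonneg_right (sq_nonneg _)

lemma enorm_symm {k : Γ → Γ → ℂ} (hk : ∀ x y, k x y = star (k y x)) (x y : Γ) :
    ‖k x y‖ₑ = ‖k y x‖ₑ := by
  rw [hk x y, ← ofReal_norm, norm_star, ofReal_norm]

open scoped Classical in
lemma kernel_sub_smul_one (T : Ell2 Γ →L[ℂ] Ell2 Γ) (c : ℂ) (x y : Γ) :
    kernel (T - c • 1) x y = kernel T x y - if x = y then c else 0 := by
  have h : (T - c • 1) (basisVec y) = T (basisVec y) - c • basisVec y := rfl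
  rw [kernel_eq, h, kernel_eq, lp.coeFn_sub, lp.coeFn_smul, Pi.sub_apply, Pi.smul_apply,
    basisVec_apply, smul_eq_mul, mul_ite, mul_one, mul_zero]

lemma kernel_sub (T T' : Ell2 Γ →L[ℂ] Ell2 Γ) (x y : Γ) :
    kernel (T - T') x y = kernel T x y - kernel T' x y := rfl

lemma weightedKernel_symm {T : Ell2 Γ →L[ℂ] Ell2 Γ}
    (hT : ∀ x y, kernel T x y = star (kernel T y x)) (x y : Γ) :
    weightedKernel T x y = weightedKernel T y x := by
  rw [weightedKernel, weightedKernel, enorm_symm hT, norm_sub_rev]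

lemma tsum_weightedKernel_sub_smul_one_le {T : Ell2 Γ →L[ℂ] Ell2 Γ} {N : ℝ≥0∞} {y : Γ}
    (h : ∑' x, weightedKernel T x y ≤ N) (c : ℂ) :
    ∑' x, weightedKernel (T - c • 1) x y ≤ N + ‖c‖ₑ := by
  classical
  calc ∑' x, weightedKernel (T - c • 1) x y
      ≤ ∑' x, (weightedKernel T x y + if x = y then ‖c‖ₑ else 0) := by
        refine ENNReal.tsum_le_tsum fun x => ?_
        rw [weightedKernel, weightedKernel, kernel_sub_smul_one]
        by_cases hxy : x = y
        · simp only [hxy, if_true, sub_self, norm_zero]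
          norm_num
          exact enorm_sub_le
        · simp [hxy]
    _ ≤ N + ‖c‖ₑ := by
        rw [ENNReal.tsum_add, tsum_ite_eq]
        gcongr

/-- A lower bound for `(T - c)²` changes by `O(|s|)` when the kernel of `T` acquires the phase of a
magnetic field `s` and a perturbation of Schur norm `O(|s|)`. -/
theorem le_norm_sub_smul_sq {T T' : Ell2 Γ →L[ℂ] Ell2 Γ} {N D : ℝ≥0} {s : ℝ}
    (hT : ∀ x y, kernel T x y = star (kernel T y x))
    (hN : ∀ y, ∑' x, weightedKernel T x y ≤ N)
    (hcol : ∀ y, ∑' x, ‖kernel T' x y - magneticKernel s (kernel T) x y‖ₑ ≤ D)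
    (hrow : ∀ x, ∑' y, ‖kernel T' x y - magneticKernel s (kernel T) x y‖ₑ ≤ D)
    {c r : ℝ} {N' : ℝ≥0} (hN' : N + |c| ≤ N') (hr : ∀ u, r * ‖u‖ ^ 2 ≤ ‖T u - (c : ℂ) • u‖ ^ 2)
    (u : Ell2 Γ) :
    (r - (N' ^ 2 * |s| + 2 * N' * D)) * ‖u‖ ^ 2 ≤ ‖T' u - (c : ℂ) • u‖ ^ 2 := by
  classical
  let A : Ell2 Γ →L[ℂ] Ell2 Γ := T - (c : ℂ) • 1
  have hA : ∀ x y, kernel A x y = star (kernel A y x) := by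
    intro x y
    rw [kernel_sub_smul_one, kernel_sub_smul_one, star_sub, ← hT]
    by_cases hxy : x = y
    · subst hxy
      simp only [if_true, ← starRingEnd_apply, Complex.conj_ofReal]
    · simp [hxy, Ne.symm hxy]
  have hAcol : ∀ y, ∑' x, weightedKernel A x y ≤ N' := by
    intro y
    refine (tsum_weightedKernel_sub_smul_one_le (hN y) (c : ℂ)).trans ?_
    rw [← ofReal_norm, Complex.norm_real, Real.norm_eq_abs, ← ENNReal.ofReal_coe_nnreal (p := N),
      ← ENNReal.ofReal_add N.coe_nonneg (abs_nonneg c), ← ENNReal.ofReal_coe_nnreal (p := N')]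
    exact ENNReal.ofReal_le_ofReal hN'
  have hArow : ∀ x, ∑' y, weightedKernel A x y ≤ N' := by
    intro x
    simp_rw [weightedKernel_symm hA x]
    exact hAcol x
  have hkcol : ∀ y, ∑' x, ‖magneticKernel s (kernel A) x y‖ₑ ≤ N' := by
    intro y
    simp_rw [enorm_magneticKernel]
    exact tsum_enorm_le_of_weight (hAcol y)
  have hkrow : ∀ x, ∑' y, ‖magneticKernel s (kernel A) x y‖ₑ ≤ N' := by
    intro x
    simp_rw [enorm_magneticKernel, enorm_symm hA x]
    exact tsum_enorm_le_of_weight (hAcol x)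
  obtain ⟨B, hBnorm, hB⟩ := exists_kernel_eq hkcol hkrow
  have hdiff (x y : Γ) : kernel (T' - (c : ℂ) • 1 - B) x y =
      kernel T' x y - magneticKernel s (kernel T) x y := by
    rw [kernel_sub, hB, kernel_sub_smul_one, magneticKernel, magneticKernel, kernel_sub_smul_one]
    by_cases hxy : x = y
    · subst hxy
      simp [flux_self]
    · simp [hxy]
  have hdnorm : ‖T' - (c : ℂ) • 1 - B‖ ≤ D :=
    norm_le_of_kernel (fun y => by simpa only [hdiff] using hcol y)
      (fun x => by simpa only [hdiff] using hrow x)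
  have hBu := le_norm_sq_of_kernel_eq_magneticKernel hB hAcol hArow (r := r) (fun v => hr v) u
  have h1 : ‖B u‖ ≤ N' * ‖u‖ := B.le_of_opNorm_le hBnorm u
  have h2 : ‖T' u - (c : ℂ) • u - B u‖ ≤ D * ‖u‖ :=
    (T' - (c : ℂ) • 1 - B).le_of_opNorm_le hdnorm u
  have h3 : ‖B u‖ ≤ ‖T' u - (c : ℂ) • u‖ + D * ‖u‖ := by
    have := norm_sub_norm_le (B u) (T' u - (c : ℂ) • u)
    rw [norm_sub_rev (B u)] at this
    linarith
  have hD : 0 ≤ (D : ℝ) * ‖u‖ := by positivity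
  have hX : 0 ≤ ‖T' u - (c : ℂ) • u‖ := norm_nonneg _
  have hY : 0 ≤ ‖B u‖ := norm_nonneg _
  have h4 : ‖B u‖ ^ 2 ≤ ‖T' u - (c : ℂ) • u‖ ^ 2 + 2 * (D * ‖u‖) * (N' * ‖u‖) := by
    rcases le_total ‖B u‖ (D * ‖u‖) with h | h
    · nlinarith [mul_le_mul h h1 hY hD]
    · nlinarith [mul_le_mul_of_nonneg_left h1 hD]
  nlinarith

lemma sqDistLipschitz_spectrum {H : ℝ → Ell2 Γ →L[ℂ] Ell2 Γ} {K : ℝ → Γ → Γ → ℂ} {N C : ℝ≥0}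
    (hsymm : ∀ b x x', K b x x' = star (K b x' x))
    (hN : ∀ b, ∀ x' : Γ,
      ∑' x : Γ, ENNReal.ofReal (1 + ‖(x : Plane) - x'‖ ^ 2) * ‖K b x x'‖ₑ ≤ N)
    (hC : ∀ b b', |b - b'| ≤ 1 →
      ∀ x', ∑' x, ‖K b x x' - K b' x x'‖ₑ ≤ C * ENNReal.ofReal |b - b'|)
    (hnorm : ∀ b, ‖H b‖ ≤ N) (hker : ∀ b, kernel (H b) = magneticKernel b (K b)) :
    SqDistLipschitz (fun b => spectrum ℝ (H b)) N
      ((2 * N + 1) ^ 2 + 2 * (2 * N + 1) * C) where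
  isClosed b := by
    have : spectrum ℝ (H b) = (fun l : ℝ => (l : ℂ)) ⁻¹' spectrum ℂ (H b) := by
      ext l
      exact mem_spectrum_real_iff
    rw [this]
    exact (spectrum.isClosed (𝕜 := ℂ) (H b)).preimage Complex.continuous_ofReal
  subset_Icc b l hl := by
    have h1 := spectrum.norm_le_norm_mul_of_mem (mem_spectrum_real_iff.1 hl)
    have h2 : ‖(1 : Ell2 Γ →L[ℂ] Ell2 Γ)‖ ≤ 1 := ContinuousLinearMap.norm_id_le
    rw [Complex.norm_real, Real.norm_eq_abs] at h1
    have h3 : |l| ≤ N := by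
      nlinarith [hnorm b, norm_nonneg (H b)]
    exact abs_le.1 h3
  radius_nonneg := N.coe_nonneg
  const_pos := by positivity
  sub_le_sq b b' hb c hc r hr l hl := by
    have hsa (b : ℝ) : ∀ x y, kernel (H b) x y = star (kernel (H b) y x) := by
      rw [hker]
      exact magneticKernel_symm (hsymm b)
    have hd (x y : Γ) : kernel (H b) x y - magneticKernel (b - b') (kernel (H b')) x y =
        magneticKernel b (fun x y => K b x y - K b' x y) x y := by
      rw [hker, hker, magneticKernel, magneticKernel, magneticKernel, magneticKernel, ← mul_assoc,
        ← Complex.exp_add, mul_sub]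
      congr 4
      push_cast
      ring
    have hD : (C * (|b - b'|).toNNReal : ℝ≥0) = (C : ℝ≥0∞) * ENNReal.ofReal |b - b'| := by
      rw [ENNReal.coe_mul]
      rfl
    have hcol (y : Γ) : ∑' x, ‖kernel (H b) x y - magneticKernel (b - b') (kernel (H b')) x y‖ₑ ≤
        (C * (|b - b'|).toNNReal : ℝ≥0) := by
      simp_rw [hd, enorm_magneticKernel]
      rw [hD]
      exact hC b b' hb y
    have hrow (x : Γ) : ∑' y, ‖kernel (H b) x y - magneticKernel (b - b') (kernel (H b')) x y‖ₑ ≤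
        (C * (|b - b'|).toNNReal : ℝ≥0) := by
      have hs : ∀ x y, K b x y - K b' x y = star (K b y x - K b' y x) := fun x y => by
        rw [star_sub, ← hsymm, ← hsymm]
      simp_rw [hd, enorm_magneticKernel, enorm_symm hs x]
      rw [hD]
      exact hC b b' hb x
    have hw : ∀ y, ∑' x, weightedKernel (H b') x y ≤ N := by
      intro y
      simp_rw [weightedKernel, hker, enorm_magneticKernel]
      exact hN b' y
    have hlow := (forall_spectrum_iff_forall_norm (isSelfAdjoint_of_kernel (hsa b')) c r).1
      fun l hl => hr l (mem_spectrum_real_iff.2 hl)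
    have := (forall_spectrum_iff_forall_norm (isSelfAdjoint_of_kernel (hsa b)) c _).2
      (le_norm_sub_smul_sq (hsa b') hw hcol hrow (N' := 2 * N + 1)
        (by push_cast; linarith) hlow) l (mem_spectrum_real_iff.1 hl)
    rw [NNReal.coe_mul, Real.coe_toNNReal _ (abs_nonneg _)] at this
    push_cast at this
    linarith

lemma subsingleton_operator [IsEmpty Γ] : Subsingleton (Ell2 Γ →L[ℂ] Ell2 Γ) :=
  ⟨fun _ _ => ext_of_kernel_eq (Subsingleton.elim _ _)⟩

lemma spectrum_nonempty [Nonempty Γ] (T : Ell2 Γ →L[ℂ] Ell2 Γ) : (spectrum ℂ T).Nonempty := by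
  classical
  have : Nontrivial (Ell2 Γ) := by
    obtain ⟨y⟩ := ‹Nonempty Γ›
    refine ⟨basisVec y, 0, fun h => ?_⟩
    have h1 := basisVec_apply y y
    simp [h] at h1
  exact spectrum.nonempty T

/-- The spectrum of a self-adjoint operator is real, so Hausdorff continuity of the real spectra
gives stability of the resolvent set in the complex plane. -/
lemma exists_le_infDist_spectrum {H : ℝ → Ell2 Γ →L[ℂ] Ell2 Γ} {R L : ℝ}
    (h : SqDistLipschitz (fun b => spectrum ℝ (H b)) R L) (hsa : ∀ b, IsSelfAdjoint (H b))
    (hne : ∀ b, (spectrum ℂ (H b)).Nonempty) {ε : ℝ} (hε : 0 < ε) :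
    ∃ δ > 0, ∃ η > 0, ∀ b₀ : ℝ, ∀ z : ℂ, ε ≤ Metric.infDist z (spectrum ℂ (H b₀)) →
      ∀ b : ℝ, |b - b₀| < δ → η ≤ Metric.infDist z (spectrum ℂ (H b)) := by
  obtain ⟨δ, hδ, hclose⟩ := h.exists_abs_sub_le (half_pos hε)
  refine ⟨δ, hδ, ε / 2, half_pos hε, fun b₀ z hz b hb => ?_⟩
  rw [Metric.le_infDist (hne b)]
  intro p hp
  have hpre : p = (p.re : ℂ) := (hsa b).mem_spectrum_eq_re hp
  obtain ⟨q, hq, hpq⟩ := hclose b b₀ hb p.re (mem_spectrum_real_iff.2 (hpre ▸ hp))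
  have h1 : dist z q ≥ ε := hz.trans (Metric.infDist_le_dist_of_mem (mem_spectrum_real_iff.1 hq))
  have h2 : dist p q ≤ ε / 2 := by
    rw [hpre, Complex.dist_eq, ← Complex.ofReal_sub, Complex.norm_real]
    exact hpq
  linarith [dist_triangle z p q]

end Harper


open Harper in
theorem corollary1
    (Γ : Set Harper.Plane) (hΓ : Harper.IsIrregularLattice Γ)
    (α : ℝ) (hα : 3 < α)
    (K : ℝ → Γ → Γ → ℂ)
    (hsymm : ∀ (b : ℝ) (x x' : Γ), K b x x' = star (K b x' x))
    (hloc : ∃ M : ℝ≥0, ∀ b : ℝ, Harper.hNorm α (K b) ≤ M)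
    (hLip : ∃ C : ℝ≥0, ∀ b b₀ : ℝ, |b - b₀| ≤ 1 →
      Harper.schurNorm (fun x x' => K b x x' - K b₀ x x') ≤ C * ENNReal.ofReal |b - b₀|) :
    ∃ H : ℝ → Harper.Ell2 Γ →L[ℂ] Harper.Ell2 Γ,
      -- `H b` is the bounded self-adjoint operator with the prescribed kernel
      (∀ b : ℝ, IsSelfAdjoint (H b) ∧
        ∀ x x' : Γ, Harper.kernel (H b) x x' = Harper.magneticKernel b (K b) x x') ∧
      -- stability of the resolvent set
      (∀ b₀ ε : ℝ, 0 < ε → ∃ δ > 0, ∃ η > 0, ∀ z : ℂ,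
        ε ≤ Metric.infDist z (spectrum ℂ (H b₀)) →
        ∀ b : ℝ, |b - b₀| < δ → η ≤ Metric.infDist z (spectrum ℂ (H b))) ∧
      -- the edges of the spectrum are Lipschitz
      (∃ L : ℝ≥0, LipschitzWith L (fun b => sSup (spectrum ℝ (H b))) ∧
        LipschitzWith L (fun b => sInf (spectrum ℝ (H b)))) ∧
      -- the edges of a gap that does not close are Lipschitz
      (4 < α → ∀ b₀ a c : ℝ, Harper.IsGap (H b₀) a c →
        ∀ I : Set ℝ, IsClosed I → I.OrdConnected → b₀ ∈ I →
          Harper.GapStaysOpen H I b₀ a c →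
          ∃ em ep : ℝ → ℝ, em b₀ = a ∧ ep b₀ = c ∧
            (∀ b ∈ I, Harper.IsGap (H b) (em b) (ep b)) ∧
            ∃ L : ℝ≥0, LipschitzOnWith L em I ∧ LipschitzOnWith L ep I) := by
  obtain ⟨M, hM⟩ := hloc
  obtain ⟨C, hC⟩ := hLip
  obtain ⟨N, hN⟩ := exists_tsum_weight_mul_le hΓ hα M
  have hcol (b : ℝ) (x' : Γ) : ∑' x, ‖magneticKernel b (K b) x x'‖ₑ ≤ N := by
    simp_rw [enorm_magneticKernel]
    exact tsum_enorm_le_of_weight (hN (K b) (hM b) x')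
  have hrow (b : ℝ) (x : Γ) : ∑' x', ‖magneticKernel b (K b) x x'‖ₑ ≤ N := by
    simp_rw [enorm_symm (magneticKernel_symm (hsymm b)) x]
    exact hcol b x
  choose H hnorm hker using fun b => exists_kernel_eq (hcol b) (hrow b)
  have hsa (b : ℝ) : IsSelfAdjoint (H b) := isSelfAdjoint_of_kernel <| by
    rw [hker]
    exact magneticKernel_symm (hsymm b)
  have hσ := sqDistLipschitz_spectrum hsymm (fun b => hN (K b) (hM b))
    (fun b b' hb x' => by
      refine le_trans (le_of_eq ?_) ((le_iSup (fun x' : Γ =>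
        ∑' x : Γ, ENNReal.ofReal ‖K b x x' - K b' x x'‖) x').trans (hC b b' hb))
      simp_rw [ofReal_norm]) hnorm hker
  refine ⟨H, fun b => ⟨hsa b, fun x x' => by rw [hker]⟩, ?_, ?_, ?_⟩
  · intro b₀ ε hε
    rcases isEmpty_or_nonempty Γ with _ | _
    -- For empty `Γ` the spectra are empty, and the distance to the empty set is zero by convention.
    · refine ⟨1, one_pos, 1, one_pos, fun z hz => absurd hz ?_⟩
      have := subsingleton_operator (Γ := Γ)
      rw [spectrum.of_subsingleton, Metric.infDist_empty]
      exact not_le.2 hε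
    · obtain ⟨δ, hδ, η, hη, h⟩ :=
        exists_le_infDist_spectrum hσ hsa (fun b => spectrum_nonempty (H b)) hε
      exact ⟨δ, hδ, η, hη, h b₀⟩
  · rcases isEmpty_or_nonempty Γ with _ | _
    · have := subsingleton_operator (Γ := Γ)
      simp_rw [spectrum.of_subsingleton]
      exact ⟨0, LipschitzWith.const _, LipschitzWith.const _⟩
    · have hne (b : ℝ) : (spectrum ℝ (H b)).Nonempty := by
        obtain ⟨p, hp⟩ := spectrum_nonempty (H b)
        exact ⟨p.re, mem_spectrum_real_iff.2 ((hsa b).mem_spectrum_eq_re hp ▸ hp)⟩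
      exact ⟨_, hσ.lipschitzWith_sSup hne, hσ.lipschitzWith_sInf hne⟩
  · intro _ b₀ a c hgap I _ hI hb₀ hopen
    exact hσ.exists_lipschitz_branch hgap hI hb₀ hopen
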